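/- Throughout, $G$ is a finite interval graph, intervals are closed real intervals, and a partial representation $\mathcal R'$ of $G$ assigns to each vertex $v$ of some set of \emph{pre-drawn} vertices an interval $\langle v\rangle'$ so that two distinct pre-drawn vertices are adjacent if and only if their intervals intersect. It is \emph{extendible} if $G$ has an interval representation in which every pre-drawn vertex $v$ is represented by $\langle v\rangle'$. Write $\mathcal R'[B]$ for the restriction of $\mathcal R'$ to the pre-drawn vertices in $B$. Two intervals \emph{single overlap} if they intersect and neither contains the other. Let $T$ be the PQ-tree of $G$, whose leaves are the maximal cliques of $G$ (P-nodes have at least two children, Q-nodes at least three): the leaf orders of the trees obtained from $T$ by permuting children of P-nodes and reversing children of Q-nodes are exactly the orderings of the maximal cliques in which the cliques containing any given vertex are consecutive. For a node $Q$ of $T$, $T[Q]$ is the subtree rooted at $Q$, and $G[Q]$ is the subgraph of $G$ induced by the vertices all of whose maximal cliques are leaves of $T[Q]$ (equivalently, the vertices in the sections of the MPQ-tree nodes in $T[Q]$). \textbf{Graphs $H_k$ of $k$-FAT obstructions} with distinguished vertices $x_k,y_k,z_k$. $H_1$ consists of a vertex $y_1$ and an induced path $P_1$ from $x_1$ to $z_1\neq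 x_1$ no vertex of which equals or is adjacent to $y_1$. $H_{k+1}$ consists of $H_k$ and an induced path $P_{k+1}$, disjoint from $H_k$, from $x_{k+1}$ to a vertex $t_{k+1}\ne x_{k+1}$, such that $t_{k+1}$ is adjacent to all vertices of $H_k$ except $x_k$, and the other vertices of $P_{k+1}$ are adjacent to no vertex of $H_k$; one sets $y_{k+1}=z_k$ and $z_{k+1}=y_k$. \textbf{$(k,\ell)$-CE obstructions.} Such an obstruction is a graph $H$ with a non-extendible partial representation $\mathcal R'_H$ such that $H$ is the union of a graph $H_k$ as above (vertices $x_k,y_k,z_k$), a graph $H'_\ell$ as above (vertices $x'_\ell,y'_\ell,z'_\ell$) and a vertex $u$, where $x_k=y'_\ell$, $y_k=x'_\ell$, $z_k=z'_\ell$ are three pairwise non-adjacent vertices, all adjacent to $u$ (other vertices of the three parts may coincide or be adjacent); exactly $z_k$ and $u$ are pre-drawn, and their intervals single overlap. A graph with a partial representation \emph{contains} $(H,\mathcal R'_H)$ if $H$ is isomorphic to an induced subgraph of it such that pre-drawn vertices are mapped to pre-drawn vertices and the endpoints of the pre-drawn intervals have the same left-to-right order. \textbf{Lemma ($(k,\ell)$-CE).}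 Let $Q$ be a Q-node of $T$ with children subtrees $T_1,\dots,T_n$, and let $a,b,c$ be maximal cliques that are leaves of $T_\alpha,T_\beta,T_\gamma$, respectively, where $\alpha<\beta<\gamma$. Let $x_k\in a$, $y_k\in c$ and $z_k\in b$ be three pairwise non-adjacent vertices, $z_k$ being pre-drawn, which have a common pre-drawn neighbour $u$ such that $\langle u\rangle'$ single overlaps $\langle z_k\rangle'$. Then the subgraph of $G$ induced by $V(G[Q])\cup\{u\}$, with the partial representation $\mathcal R'[\{z_k,u\}]$, contains a $(k,\ell)$-CE obstruction for some integers $k\ge 1$ and $\ell$ with either $\ell=1$ or $k=\ell=2$. -/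

import Mathlib

universe u

namespace IntervalExt

/-! ### Partial interval representations -/

/-- A partial interval representation of `G`: the vertices of `pre` are pre-drawn, each as the
closed interval `[left v, right v]`, and these intervals represent the subgraph induced by `pre`.
The values of `left` and `right` outside `pre` carry no meaning. -/
structure PartialRep {V : Type u} (G : SimpleGraph V) where
  pre : Set V
  left : V → ℝ
  right : V → ℝ
  left_le_right : ∀ v ∈ pre, left v ≤ right v
  adj_iff : ∀ v ∈ pre, ∀ w ∈ pre, v ≠ w →
    (G.Adj v w ↔ (Set.Icc (left v) (right v) ∩ Set.Icc (left w) (right w)).Nonempty)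

variable {V : Type u} {G : SimpleGraph V}

/-- The interval drawn for a pre-drawn vertex. -/
def PartialRep.interval (R : PartialRep G) (v : V) : Set ℝ := Set.Icc (R.left v) (R.right v)

/-- `G` is an interval graph: it has a representation in which every vertex is drawn. -/
def IsIntervalGraph (G : SimpleGraph V) : Prop :=
  ∃ R : PartialRep G, R.pre = Set.univ

/-- `R` extends to a representation of the whole graph, with the same pre-drawn intervals. -/
def PartialRep.Extendible (R : PartialRep G) : Prop :=
  ∃ S : PartialRep G, S.pre = Set.univ ∧
    ∀ v ∈ R.pre, S.left v = R.left v ∧ S.right v = R.right v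

/-- The partial representation in which only the pre-drawn vertices belonging to `B` stay
pre-drawn. -/
def PartialRep.restrict (R : PartialRep G) (B : Set V) : PartialRep G where
  pre := R.pre ∩ B
  left := R.left
  right := R.right
  left_le_right := fun v hv => R.left_le_right v hv.1
  adj_iff := fun v hv w hw h => R.adj_iff v hv.1 w hw.1 h

/-- The partial representation induced on the subgraph of `G` induced by `A`. -/
def PartialRep.induce (R : PartialRep G) (A : Set V) : PartialRep (G.induce A) where
  pre := {v | (v : V) ∈ R.pre}
  left := fun v => R.left v
  right := fun v => R.right v
  left_le_right := fun v hv => R.left_le_right v hv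
  adj_iff := fun v hv w hw h => R.adj_iff v hv w hw (fun e => h (Subtype.ext e))

/-- Two intervals single overlap: they intersect and neither contains the other. -/
def SingleOverlap (I J : Set ℝ) : Prop := (I ∩ J).Nonempty ∧ ¬ I ⊆ J ∧ ¬ J ⊆ I

/-! ### PQ-trees -/

/-- Ordered trees whose inner nodes are P-nodes or Q-nodes and whose leaves are labelled
by `α`. -/
inductive PQTree (α : Type u) : Type u
  | leaf (a : α) : PQTree α
  | pnode (cs : List (PQTree α)) : PQTree α
  | qnode (cs : List (PQTree α)) : PQTree α

namespace PQTree

variable {α : Type u}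

mutual
/-- The labels of the leaves, from left to right. -/
def frontier : PQTree α → List α
  | leaf a => [a]
  | pnode cs => frontierList cs
  | qnode cs => frontierList cs
/-- The labels of the leaves of a list of trees, from left to right. -/
def frontierList : List (PQTree α) → List α
  | [] => []
  | c :: cs => frontier c ++ frontierList cs
end

/-- P-nodes have at least two children and Q-nodes have at least three. -/
inductive Proper : PQTree α → Prop
  | leaf (a : α) : Proper (leaf a)
  | pnode (cs : List (PQTree α)) : 2 ≤ cs.length → (∀ c ∈ cs, Proper c) → Proper (pnode cs)
  | qnode (cs : List (PQTree α)) : 3 ≤ cs.length → (∀ c ∈ cs, Proper c) → Proper (qnode cs)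

/-- `IsSubtree S T`: `S` is the subtree of `T` rooted at some node of `T`. -/
inductive IsSubtree (S : PQTree α) : PQTree α → Prop
  | refl : IsSubtree S S
  | pnode (cs : List (PQTree α)) (c : PQTree α) : c ∈ cs → IsSubtree S c → IsSubtree S (pnode cs)
  | qnode (cs : List (PQTree α)) (c : PQTree α) : c ∈ cs → IsSubtree S c → IsSubtree S (qnode cs)

/-- Equivalence of PQ-trees: one is obtained from the other by arbitrarily reordering the
children of P-nodes and reversing the children of Q-nodes, finitely often and at any nodes. -/
inductive Equivalent : PQTree α → PQTree α → Prop
  | refl (T : PQTree α) : Equivalent T T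
  | trans {T₁ T₂ T₃ : PQTree α} : Equivalent T₁ T₂ → Equivalent T₂ T₃ → Equivalent T₁ T₃
  | permute {cs ds : List (PQTree α)} : cs.Perm ds → Equivalent (pnode cs) (pnode ds)
  | reverse (cs : List (PQTree α)) : Equivalent (qnode cs) (qnode cs.reverse)
  | pchild (l r : List (PQTree α)) {c d : PQTree α} : Equivalent c d →
      Equivalent (pnode (l ++ c :: r)) (pnode (l ++ d :: r))
  | qchild (l r : List (PQTree α)) {c d : PQTree α} : Equivalent c d →
      Equivalent (qnode (l ++ c :: r)) (qnode (l ++ d :: r))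

end PQTree

/-- `l` lists all maximal cliques of `G`, each exactly once, in such an order that the maximal
cliques containing any given vertex appear consecutively. -/
def IsConsecutiveOrdering (G : SimpleGraph V) (l : List (Set V)) : Prop :=
  l.Nodup ∧ (∀ s : Set V, s ∈ l ↔ Maximal G.IsClique s) ∧
    ∀ a b c : Set V, [a, b, c].Sublist l → a ∩ c ⊆ b

/-- `T` is the PQ-tree of `G`: the frontiers of the trees equivalent to `T` are exactly the
consecutive orderings of the maximal cliques of `G`. -/
def PQTree.Represents (T : PQTree (Set V)) (G : SimpleGraph V) : Prop :=
  T.Proper ∧ ∀ l : List (Set V),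
    (∃ T' : PQTree (Set V), T.Equivalent T' ∧ T'.frontier = l) ↔ IsConsecutiveOrdering G l

/-- The vertices of `G[N]`, for a node `N` of the PQ-tree of `G` with subtree `S = T[N]`: those
that the MPQ-tree places in the sections of the nodes of `T[N]`. The MPQ-tree places a vertex at
the lowest node below which all maximal cliques containing the vertex are found, so these are the
vertices all of whose maximal cliques are leaves of `T[N]`. -/
def subtreeVertices (G : SimpleGraph V) (S : PQTree (Set V)) : Set V :=
  {v | ∀ s : Set V, Maximal G.IsClique s → v ∈ s → s ∈ S.frontier}

/-! ### Obstructions -/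

/-- `FATGraph G k S x y z`: the subgraph of `G` induced by `S` is the graph `H_k` of a `k`-FAT
obstruction (forced asteroidal triple), with `x_k = x`, `y_k = y` and `z_k = z`.

* `H_1` consists of a vertex `y_1` and of an induced path `P_1` from `x_1` to `z_1`, no vertex of
  which is `y_1` or adjacent to `y_1`.
* `H_{k+1}` consists of `H_k` and of an induced path `P_{k+1}`, disjoint from `H_k`, from
  `x_{k+1}` to another vertex `t_{k+1}`, where `t_{k+1}` is adjacent to all vertices of `H_k`
  except for `x_k`, and the other vertices of `P_{k+1}` are adjacent to no vertex of `H_k`;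
  moreover `y_{k+1} = z_k` and `z_{k+1} = y_k`. -/
inductive FATGraph (G : SimpleGraph V) : ℕ → Set V → V → V → V → Prop
  | one (x y z : V) (p : G.Walk x z) (hxz : x ≠ z) (hp : p.IsPath) (hc : p.IsChordless)
      (hy : ∀ v ∈ p.support, v ≠ y ∧ ¬ G.Adj v y) :
      FATGraph G 1 (insert y {v | v ∈ p.support}) x y z
  | succ (k : ℕ) (S : Set V) (x y z : V) (h : FATGraph G k S x y z)
      (x' t : V) (p : G.Walk x' t) (hxt : x' ≠ t) (hp : p.IsPath) (hc : p.IsChordless)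
      (hdisj : ∀ v ∈ p.support, v ∉ S)
      (hx : ¬ G.Adj t x) (ht : ∀ s ∈ S, s ≠ x → G.Adj t s)
      (hnadj : ∀ v ∈ p.support, v ≠ t → ∀ s ∈ S, ¬ G.Adj v s) :
      FATGraph G (k + 1) (S ∪ {v | v ∈ p.support}) x' z y

/-- `H` with the partial representation `R` is a `(k, ℓ)`-CE obstruction (covered endpoint). The
graph is glued from the graph `H_k` of a `k`-FAT obstruction, the graph `H'_ℓ` of an `ℓ`-FAT
obstruction and a vertex `u`, where `x_k = y'_ℓ = x`, `y_k = x'_ℓ = y` and `z_k = z'_ℓ = z` are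
pairwise non-adjacent and `u` is adjacent to all three; further vertices may be shared (for
instance `u` may be the vertex `t_k`). Exactly `z` and `u` are pre-drawn, with single overlapping
intervals. As every obstruction, it is not extendible. -/
def IsCEObstruction {W : Type u} (k l : ℕ) (H : SimpleGraph W) (R : PartialRep H) : Prop :=
  ∃ (x y z u : W) (S S' : Set W),
    FATGraph H k S x y z ∧ FATGraph H l S' y x z ∧ S ∪ S' ∪ {u} = Set.univ ∧
    x ≠ y ∧ x ≠ z ∧ y ≠ z ∧ ¬ H.Adj x y ∧ ¬ H.Adj x z ∧ ¬ H.Adj y z ∧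
    H.Adj u x ∧ H.Adj u y ∧ H.Adj u z ∧
    R.pre = {z, u} ∧ SingleOverlap (R.interval u) (R.interval z) ∧
    ¬ R.Extendible

/-- `G` and `R` contain `H` and `RH`: `H` is an induced subgraph of `G` so that pre-drawn vertices
are mapped to pre-drawn vertices, and the endpoints of the pre-drawn intervals have the same
left-to-right order. -/
def Contains {W : Type u} (R : PartialRep G) {H : SimpleGraph W} (RH : PartialRep H) : Prop :=
  ∃ f : H ↪g G, (∀ w ∈ RH.pre, f w ∈ R.pre) ∧
    ∀ v ∈ RH.pre, ∀ w ∈ RH.pre,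
      (RH.left v ≤ RH.left w ↔ R.left (f v) ≤ R.left (f w)) ∧
      (RH.left v ≤ RH.right w ↔ R.left (f v) ≤ R.right (f w)) ∧
      (RH.right v ≤ RH.left w ↔ R.right (f v) ≤ R.left (f w)) ∧
      (RH.right v ≤ RH.right w ↔ R.right (f v) ≤ R.right (f w))

/-- `G` and `R` contain some `(k, ℓ)`-CE obstruction. -/
def ContainsCE (k l : ℕ) (R : PartialRep G) : Prop :=
  ∃ (W : Type u) (H : SimpleGraph W) (RH : PartialRep H),
    IsCEObstruction k l H RH ∧ Contains R RH

end IntervalExt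

/-!
Fix an interval representation of `G` and suppose that `x`, `z` and `y` are drawn from left to
right. Since the Q-node can only be reversed, every representation of `G` draws `z` between `x` and
`y` (`PQTree.Represents.forced`): the maximal cliques, ordered by the points of a representation at
which they are found, form a leaf order of an equivalent tree. Write this as `Forced G x z y`. From
here on, the PQ-tree is only needed to confine the obstruction. The vertices below the Q-node form a
module (`PQTree.Represents.isModule_subtreeVertices`), and a graph `H_k` whose vertices `y_k` and
`z_k` belong to a module lies in that module (`FATGraph.subset_module`).

The graphs `H_k` come from reflecting a part of the representation. By `IsRep.exists_flip`, an
interval of the line can be reflected unless some vertex overlaps it and misses a vertex that meets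
it. Start with `z` and `y`, add what is connected to `z` without the closed neighbourhood of `y` and
vice versa, and keep adding what can be entered through common neighbours of `z` and `y` that miss
some vertex added on the opposite side (`Reach`). If `x` were never added, everything added could be
reflected, which would draw `y` between `x` and `z` (`Forced.exists_reach`). If `x` is added, then
the alternation of the two sides is precisely the recursion that builds a graph `H_k` with
`x_k = x`, `y_k = y` and `z_k = z` (`exists_fatGraph_of_reach`).

If `y` and `z` are connected without the closed neighbourhood of `x`, a shortest path gives `H'_1`,
and `ℓ = 1`; the mirror image is settled by interchanging `x` and `y`. Otherwise another reflection
argument shows that two turns suffice on both sides, after `x` and `y` have been replaced by the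
vertices of their components that come closest to `z` (`Forced.exists_fatGraph_two`); these are
still neighbours of `u`, which covers everything between `x` and `y`.

Conversely, no representation draws `y_k` between `x_k` and `z_k` (`FATGraph.not_btw`), so the two
graphs force `z` between `x` and `y`. There, `z` is covered by the common neighbour `u`, and the
obstruction is not extendible (`not_extendible_of_fatGraph`).
-/

namespace IntervalExt

variable {V : Type u} {G : SimpleGraph V}

/-! ### Chordless paths -/

/-- If a walk to `t` meets a set `D`, then inside its support there is a chordless path to `t`
that starts in `D` and has no further vertex in `D`. -/
theorem exists_chordless_path {x t : V} (p : G.Walk x t) (D : V → Prop)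
    (hD : ∃ v ∈ p.support, D v) :
    ∃ (c : V) (q : G.Walk c t), q.IsPath ∧ q.IsChordless ∧ D c ∧
      (∀ v ∈ q.support, v ∈ p.support) ∧ ∀ v ∈ q.support, v ≠ c → ¬ D v := by
  induction p generalizing D with
  | @nil s =>
    obtain ⟨v, hv, hDv⟩ := hD
    obtain rfl : v = s := by simpa using hv
    refine ⟨v, .nil, by simp, ?_, hDv, by simp, by simp⟩
    rw [SimpleGraph.Walk.isChordless_iff_forall_mem_edges]
    intro a b ha hb hab
    simp at ha hb
    subst ha hb
    exact absurd hab G.irrefl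
  | @cons a b w h p ih =>
    by_cases hp : ∃ v ∈ p.support, D v
    · obtain ⟨c, q, h1, h2, h3, h4, h5⟩ := ih D hp
      exact ⟨c, q, h1, h2, h3, fun v hv => by simp [h4 v hv], h5⟩
    · push Not at hp
      have hDa : D a := by
        obtain ⟨v, hv, hDv⟩ := hD
        rw [SimpleGraph.Walk.support_cons, List.mem_cons] at hv
        rcases hv with rfl | hv
        · exact hDv
        · exact absurd hDv (hp v hv)
      -- Enter the rest of the walk at the last neighbour of `a` on it.
      obtain ⟨c, q, h1, h2, h3, h4, h5⟩ :=
        ih (fun v => G.Adj a v) ⟨b, p.start_mem_support, h⟩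
      have ha : a ∉ q.support := fun ha => hp a (h4 a ha) hDa
      refine ⟨a, .cons h3 q, (SimpleGraph.Walk.cons_isPath_iff _ _).2 ⟨h1, ha⟩, ?_, hDa, ?_, ?_⟩
      · rw [SimpleGraph.Walk.isChordless_iff_forall_mem_edges] at h2 ⊢
        intro v w hv hw hvw
        rw [SimpleGraph.Walk.support_cons, List.mem_cons] at hv hw
        rw [SimpleGraph.Walk.edges_cons, List.mem_cons]
        rcases hv with rfl | hv <;> rcases hw with rfl | hw
        · exact absurd hvw G.irrefl
        · by_cases hwc : w = c
          · left; rw [hwc]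
          · exact absurd hvw (h5 w hw hwc)
        · by_cases hvc : v = c
          · left; rw [hvc, Sym2.eq_swap]
          · exact absurd hvw.symm (h5 v hv hvc)
        · exact Or.inr (h2 hv hw hvw)
      · intro v hv
        rw [SimpleGraph.Walk.support_cons, List.mem_cons] at hv ⊢
        exact hv.imp_right (h4 v)
      · intro v hv hva
        rw [SimpleGraph.Walk.support_cons, List.mem_cons] at hv
        exact hp v (h4 v (hv.resolve_left hva))

/-! ### Interval representations -/

/-- The intervals `[l v, r v]`, for all vertices `v`, represent `G`. -/
structure IsRep (G : SimpleGraph V) (l r : V → ℝ) : Prop where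
  le : ∀ v, l v ≤ r v
  adj_iff : ∀ v w, v ≠ w → (G.Adj v w ↔ l v ≤ r w ∧ l w ≤ r v)

/-- The interval of `q` lies strictly between those of `p` and `s`. -/
def Btw (l r : V → ℝ) (p q s : V) : Prop :=
  (r p < l q ∧ r q < l s) ∨ (r s < l q ∧ r q < l p)

theorem IsRep.reflect {l r : V → ℝ} (h : IsRep G l r) :
    IsRep G (fun v => -r v) (fun v => -l v) := by
  refine ⟨fun v => neg_le_neg (h.le v), fun v w hvw => ?_⟩
  rw [h.adj_iff v w hvw, neg_le_neg_iff, neg_le_neg_iff]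
  exact and_comm

theorem Btw.reflect {l r : V → ℝ} {p q s : V} (h : Btw l r p q s) :
    Btw (fun v => -r v) (fun v => -l v) p q s := by
  unfold Btw at *
  rcases h with h | h
  · right; constructor <;> linarith
  · left; constructor <;> linarith

theorem Btw.symm {l r : V → ℝ} {p q s : V} (h : Btw l r p q s) : Btw l r s q p := Or.symm h

namespace IsRep

variable {l r : V → ℝ}

theorem adj_or_eq (h : IsRep G l r) {v w : V} (h1 : l v ≤ r w) (h2 : l w ≤ r v) :
    v = w ∨ G.Adj v w := by
  by_cases hvw : v = w
  · exact Or.inl hvw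
  · exact Or.inr ((h.adj_iff v w hvw).2 ⟨h1, h2⟩)

theorem adj_le (h : IsRep G l r) {v w : V} (hvw : G.Adj v w) : l v ≤ r w ∧ l w ≤ r v :=
  (h.adj_iff v w hvw.ne).1 hvw

theorem lt_or_lt (h : IsRep G l r) {v w : V} (h1 : v ≠ w) (h2 : ¬ G.Adj v w) :
    r v < l w ∨ r w < l v := by
  by_contra hc
  push Not at hc
  exact h2 ((h.adj_iff v w h1).2 ⟨hc.2, hc.1⟩)

theorem not_adj_of_lt (h : IsRep G l r) {v w : V} (h1 : r v < l w) : v ≠ w ∧ ¬ G.Adj v w := by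
  refine ⟨?_, fun h2 => ?_⟩
  · rintro rfl
    exact absurd (h.le v) (not_le.2 h1)
  · have := h.adj_le h2
    linarith

/-- Passing to a neighbour does not jump over a vertex. -/
theorem lt_of_adj (h : IsRep G l r) {c d d' : V} (h1 : r c < l d) (h2 : G.Adj d d')
    (h3 : c ≠ d') (h4 : ¬ G.Adj c d') : r c < l d' := by
  have h5 := h.adj_le h2
  rcases h.lt_or_lt h3 h4 with h6 | h6
  · exact h6
  · linarith [h.le c]

theorem gt_of_adj (h : IsRep G l r) {c d d' : V} (h1 : r d < l c) (h2 : G.Adj d d')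
    (h3 : c ≠ d') (h4 : ¬ G.Adj c d') : r d' < l c := by
  have h5 := h.adj_le h2
  rcases h.lt_or_lt h3 h4 with h6 | h6
  · linarith [h.le c]
  · exact h6

theorem common_adj (hR : IsRep G l r) {a b s t : V} (hab : a ≠ b) (nab : ¬ G.Adj a b)
    (hsa : G.Adj s a) (hsb : G.Adj s b) (hta : G.Adj t a) (htb : G.Adj t b) :
    s = t ∨ G.Adj s t := by
  have h1 := hR.adj_le hsa
  have h2 := hR.adj_le hsb
  have h3 := hR.adj_le hta
  have h4 := hR.adj_le htb
  rcases hR.lt_or_lt hab nab with h | h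
  · exact hR.adj_or_eq (by linarith) (by linarith)
  · exact hR.adj_or_eq (by linarith) (by linarith)

end IsRep

/-! ### Vertices forced by alternating paths -/

/-- `Reach G l r k a b c`: the vertex `c` is forced to the side of `a` in at most `k` turns.
With no turn, `c` lies in the component of `a` in the graph without the closed neighbourhood of
`b`. Each turn uses a common neighbour `t` of `a` and `b` that misses a vertex `e` forced to the
side of `b`, in order to enter a further component, on the far side of `a` from `b`. -/
inductive Reach (G : SimpleGraph V) (l r : V → ℝ) : ℕ → V → V → V → Prop
  | base (k : ℕ) (a b : V) : Reach G l r k a b a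
  | adj {k : ℕ} {a b d c : V} : Reach G l r k a b d → G.Adj d c → c ≠ b → ¬ G.Adj c b →
      Reach G l r k a b c
  | turn {k : ℕ} {a b e t c : V} : Reach G l r k b a e → G.Adj t a → G.Adj t b → ¬ G.Adj t e →
      G.Adj t c → Btw l r c a b → Reach G l r (k + 1) a b c
  | mono {k : ℕ} {a b c : V} : Reach G l r k a b c → Reach G l r (k + 1) a b c

namespace Reach

variable {l r : V → ℝ} {k : ℕ} {a b c d e t : V}

theorem reflect (h : Reach G l r k a b c) :
    Reach G (fun v => -r v) (fun v => -l v) k a b c := by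
  induction h with
  | base => exact .base ..
  | adj _ h1 h2 h3 ih => exact .adj ih h1 h2 h3
  | turn _ h1 h2 h3 h4 h5 ih => exact .turn ih h1 h2 h3 h4 h5.reflect
  | mono _ ih => exact .mono ih

theorem reflect_iff : Reach G (fun v => -r v) (fun v => -l v) k a b c ↔ Reach G l r k a b c :=
  ⟨fun h => by simpa using h.reflect, reflect⟩

theorem mono_le {j : ℕ} (h : Reach G l r j a b c) (hjk : j ≤ k) : Reach G l r k a b c := by
  induction hjk with
  | refl => exact h
  | step _ ih => exact .mono ih

theorem lt_of_lt (hR : IsRep G l r) (hab : r a < l b) (h : Reach G l r k a b c) : r c < l b := by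
  induction h with
  | base => exact hab
  | adj _ h1 h2 h3 ih =>
    exact hR.gt_of_adj (ih hab) h1 h2.symm (fun h => h3 h.symm)
  | @turn k a b e t c _ _ _ _ _ h5 ih =>
    have := hR.le a
    have := hR.le b
    rcases h5 with h5 | h5 <;> linarith
  | mono _ ih => exact ih hab

theorem lt_of_gt (hR : IsRep G l r) (hab : r b < l a) (h : Reach G l r k a b c) : r b < l c := by
  have := h.reflect.lt_of_lt hR.reflect (neg_lt_neg hab)
  simpa using this

/-- A vertex on the far side of `a` that is not reached lies beyond all reached vertices. -/
theorem lt_of_not_reach (hR : IsRep G l r) (hca : r c < l a) (hab : r a < l b)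
    (hc : ¬ Reach G l r k a b c) (hd : Reach G l r k a b d) : r c < l d := by
  have hcb : r c < l b := by linarith [hR.le a]
  induction hd with
  | base => exact hca
  | @adj k a b d' d hd' h1 h2 h3 ih =>
    have h6 := hR.not_adj_of_lt hcb
    refine hR.lt_of_adj (ih hca hab hc hcb) h1 ?_ ?_
    · rintro rfl
      exact hc (.adj hd' h1 h2 h3)
    · intro h7
      exact hc (.adj (.adj hd' h1 h2 h3) h7.symm h6.1 h6.2)
  | @turn k a b e t d he h1 h2 h3 h4 h5 ih =>
    have h6 := hR.not_adj_of_lt hcb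
    have hB : Btw l r c a b := Or.inl ⟨hca, hab⟩
    have h7 : r c < l t := by
      refine hR.lt_of_adj hca h1.symm ?_ ?_
      · rintro rfl
        exact h6.2 h2
      · intro h7
        exact hc (.turn he h1 h2 h3 h7.symm hB)
    refine hR.lt_of_adj h7 h4 ?_ ?_
    · rintro rfl
      exact hc (.turn he h1 h2 h3 h4 hB)
    · intro h8
      exact hc (.adj (.turn he h1 h2 h3 h4 h5) h8.symm h6.1 h6.2)
  | mono _ ih => exact ih hca hab (fun h => hc h.mono) hcb

/-- A common neighbour of `b` and of a vertex beyond all reached vertices sees all of them. -/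
theorem adj_of_not_reach (hR : IsRep G l r) (hB : Btw l r c a b)
    (hc : ¬ Reach G l r k a b c) (htc : G.Adj t c) (htb : G.Adj t b)
    (hd : Reach G l r k a b d) : G.Adj t d := by
  have key : ∀ {l r : V → ℝ}, IsRep G l r → r c < l a → r a < l b →
      ¬ Reach G l r k a b c → Reach G l r k a b d → G.Adj t d := by
    intro l r hR h1 h2 hc hd
    have h3 := lt_of_not_reach hR h1 h2 hc hd
    have h4 := lt_of_lt hR h2 hd
    have h5 := hR.adj_le htc
    have h6 := hR.adj_le htb
    have h7 := hR.le d
    rcases hR.adj_or_eq (v := t) (w := d) (by linarith) (by linarith) with h | h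
    · subst h
      exact absurd htb (hR.not_adj_of_lt h4).2
    · exact h
  rcases hB with ⟨h1, h2⟩ | ⟨h1, h2⟩
  · exact key hR h1 h2 hc hd
  · exact key hR.reflect (neg_lt_neg h2) (neg_lt_neg h1) (by rwa [reflect_iff]) hd.reflect

theorem not_adj_of_btw (hR : IsRep G l r) (hB : Btw l r c a b) (he : Reach G l r k b a e) :
    c ≠ e ∧ ¬ G.Adj c e := by
  rcases hB with ⟨h1, h2⟩ | ⟨h1, h2⟩
  · have := he.lt_of_gt hR h2
    exact hR.not_adj_of_lt (by linarith [hR.le a])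
  · have := he.lt_of_lt hR h1
    have := hR.not_adj_of_lt (v := e) (w := c) (by linarith [hR.le a])
    exact ⟨this.1.symm, fun h => this.2 h.symm⟩

/-- The vertices reached without a turn are joined to `a` outside the closed neighbourhood
of `b`. -/
theorem exists_walk_zero (h : Reach G l r 0 a b c) (hab : a ≠ b) (nab : ¬ G.Adj a b) :
    ∃ p : G.Walk c a, ∀ v ∈ p.support, Reach G l r 0 a b v ∧ v ≠ b ∧ ¬ G.Adj v b := by
  generalize hk : (0 : ℕ) = k at h
  induction h with
  | base => subst hk; exact ⟨.nil, by simpa using ⟨.base .., hab, nab⟩⟩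
  | adj h0 h1 h2 h3 ih =>
    subst hk
    obtain ⟨p, hp⟩ := ih hab nab rfl
    refine ⟨.cons h1.symm p, ?_⟩
    intro v hv
    rw [SimpleGraph.Walk.support_cons, List.mem_cons] at hv
    rcases hv with rfl | hv
    · exact ⟨.adj h0 h1 h2 h3, h2, h3⟩
    · exact hp v hv
  | turn => cases hk
  | mono => cases hk

/-- A vertex whose last turn is the `(k + 1)`-st is joined to the common neighbour used in that
turn through vertices of the same kind. -/
theorem exists_walk_succ (hR : IsRep G l r) (h : Reach G l r (k + 1) a b c)
    (hc : ¬ Reach G l r k a b c) :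
    ∃ t e, Reach G l r k b a e ∧ G.Adj t a ∧ G.Adj t b ∧ ¬ G.Adj t e ∧
      ∃ c₀, G.Adj t c₀ ∧ ¬ Reach G l r k a b c₀ ∧ Btw l r c₀ a b ∧
      ∃ p : G.Walk c t, ∀ v ∈ p.support,
        v = t ∨ (Reach G l r (k + 1) a b v ∧ ¬ Reach G l r k a b v ∧ Btw l r v a b) := by
  have key : Reach G l r (k + 1) a b c → ¬ Reach G l r k a b c →
    (∃ t e, Reach G l r k b a e ∧ G.Adj t a ∧ G.Adj t b ∧ ¬ G.Adj t e ∧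
      ∃ c₀, G.Adj t c₀ ∧ ¬ Reach G l r k a b c₀ ∧ Btw l r c₀ a b ∧
      ∃ p : G.Walk c t, ∀ v ∈ p.support,
        v = t ∨ (Reach G l r (k + 1) a b v ∧ ¬ Reach G l r k a b v ∧ Btw l r v a b)) ∧
      Btw l r c a b := by
    clear h hc
    intro h
    generalize hm : k + 1 = m at h
    induction h with
    | base => intro hc; exact absurd (.base ..) hc
    | @adj m a b d c h0 h1 h2 h3 ih =>
      intro hc
      subst hm
      have hd : ¬ Reach G l r k a b d := fun hd => hc (.adj hd h1 h2 h3)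
      obtain ⟨⟨t, e, g1, g2, g3, g4, c₀, g5, g6, g7, p, hp⟩, hB⟩ := ih rfl hd
      have hca : c ≠ a := by rintro rfl; exact hc (.base ..)
      have nca : ¬ G.Adj c a := fun h => hc (.adj (.base ..) h.symm h2 h3)
      have hB' : Btw l r c a b := by
        have nac : ¬ G.Adj a c := fun h => nca h.symm
        exact hB.imp (fun h => ⟨hR.gt_of_adj h.1 h1 hca.symm nac, h.2⟩)
          (fun h => ⟨h.1, hR.lt_of_adj h.2 h1 hca.symm nac⟩)
      refine ⟨⟨t, e, g1, g2, g3, g4, c₀, g5, g6, g7, .cons h1.symm p, ?_⟩, hB'⟩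
      intro v hv
      rw [SimpleGraph.Walk.support_cons, List.mem_cons] at hv
      rcases hv with rfl | hv
      · exact Or.inr ⟨.adj h0 h1 h2 h3, hc, hB'⟩
      · exact hp v hv
    | @turn m a b e t c h0 h1 h2 h3 h4 h5 ih =>
      intro hc
      obtain rfl : k = m := by omega
      refine ⟨⟨t, e, h0, h1, h2, h3, c, h4, hc, h5, .cons h4.symm .nil, ?_⟩, h5⟩
      intro v hv
      simp only [SimpleGraph.Walk.support_cons, SimpleGraph.Walk.support_nil, List.mem_cons,
        List.not_mem_nil, or_false] at hv
      rcases hv with rfl | rfl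
      · exact Or.inr ⟨.turn h0 h1 h2 h3 h4 h5, hc, h5⟩
      · exact Or.inl rfl
    | mono h ih =>
      intro hc
      obtain rfl : k = _ := Nat.succ_injective hm
      exact absurd h hc
  exact (key h hc).1

end Reach

variable {l r : V → ℝ}

/-! ### Construction of the graphs of `k`-FAT obstructions -/

/-- The vertices that a graph `H_{k+1}` may use besides those reached on the side of `a` in
exactly `k` turns: the vertices `a` and `b`, the vertices reached in fewer turns on either side, and
the common neighbours of `a` and `b` that the turns made so far can use: on the side of `a` up to
the `k`-th turn, on the side of `b` up to the one before. -/
def Earlier (G : SimpleGraph V) (l r : V → ℝ) (k : ℕ) (a b : V) : Set V :=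
  {v | v = a ∨ v = b ∨ (∃ j < k, Reach G l r j a b v ∨ Reach G l r j b a v) ∨
    (G.Adj v a ∧ G.Adj v b ∧ ((∃ j < k, ∃ e, Reach G l r j b a e ∧ ¬ G.Adj v e) ∨
      ∃ j, j + 1 < k ∧ ∃ e, Reach G l r j a b e ∧ ¬ G.Adj v e))}

/-- If a set `D` contains a vertex reached in `k` turns but no earlier vertex, then `D` contains
the vertex `x_{k+1}` of a graph `H_{k+1}`, and no other vertex of that graph. The set `D` is what
makes the induction work: for the next turn it consists of the non-neighbours of the common
neighbour that becomes `t_{k+2}`. -/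
theorem exists_fatGraph_of_reach (hR : IsRep G l r) {k : ℕ} {a b c : V} (hab : a ≠ b)
    (nab : ¬ G.Adj a b) {D : V → Prop} (hD : ∀ v ∈ Earlier G l r k a b, ¬ D v)
    (hc : Reach G l r k a b c) (hDc : D c) :
    ∃ (c' : V) (S : Set V), D c' ∧ FATGraph G (k + 1) S c' b a ∧ (∀ s ∈ S, s ≠ c' → ¬ D s) ∧
      ∀ s ∈ S, s ∈ Earlier G l r k a b ∨ Reach G l r k a b s := by
  induction k generalizing a b c D with
  | zero =>
    obtain ⟨p, hp⟩ := hc.exists_walk_zero hab nab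
    obtain ⟨c', q, h1, h2, h3, h4, h5⟩ := exists_chordless_path p D ⟨c, p.start_mem_support, hDc⟩
    refine ⟨c', _, h3, .one c' b a q ?_ h1 h2 fun v hv => (hp v (h4 v hv)).2, ?_, ?_⟩
    · rintro rfl
      exact hD _ (Or.inl rfl) h3
    · rintro s (rfl | hs) hsc
      · exact hD _ (Or.inr (Or.inl rfl))
      · exact h5 s hs hsc
    · rintro s (rfl | hs)
      · exact Or.inl (Or.inr (Or.inl rfl))
      · exact Or.inr (hp s (h4 s hs)).1
  | succ k ih =>
    have hck : ¬ Reach G l r k a b c := fun h =>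
      hD c (Or.inr (Or.inr (Or.inl ⟨k, k.lt_succ_self, Or.inl h⟩))) hDc
    obtain ⟨t, e, he, hta, htb, hte, c₀, htc₀, hc₀, hB, p, hp⟩ := hc.exists_walk_succ hR hck
    have nba : ¬ G.Adj b a := fun h => nab h.symm
    -- `t` sees everything earlier than `e`, since otherwise it could have been used before.
    have hD' : ∀ v ∈ Earlier G l r k b a, ¬ ¬ G.Adj t v := by
      intro v hv hn
      have hleft : ∀ j ≤ k, Reach G l r j a b v → False := fun j hj h =>
        hn (Reach.adj_of_not_reach hR hB hc₀ htc₀ htb (h.mono_le hj))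
      have hright : ∀ j < k, ∀ w, Reach G l r j b a w → G.Adj t w := fun j hj w h => by
        by_contra hn
        exact hc₀ ((Reach.turn h hta htb hn htc₀ hB).mono_le hj)
      rcases hv with rfl | rfl | ⟨j, hj, h | h⟩ | ⟨h1, h2, h⟩
      · exact hn htb
      · exact hn hta
      · exact hn (hright j hj v h)
      · exact hleft j hj.le h
      · rcases hR.common_adj hab nab hta htb h2 h1 with rfl | h3
        · rcases h with ⟨j, hj, e', h, hn'⟩ | ⟨j, hj, e', h, hn'⟩
          · exact hn' (Reach.adj_of_not_reach hR hB hc₀ htc₀ htb (h.mono_le hj.le))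
          · exact hn' (hright j (by omega) e' h)
        · exact hn h3
    obtain ⟨x, S, hx, hS, hSx, hSE⟩ := ih hab.symm nba hD' he hte
    obtain ⟨c', q, h1, h2, h3, h4, h5⟩ := exists_chordless_path p D ⟨c, p.start_mem_support, hDc⟩
    have htE : t ∈ Earlier G l r (k + 1) a b :=
      Or.inr (Or.inr (Or.inr ⟨hta, htb, Or.inl ⟨k, k.lt_succ_self, e, he, hte⟩⟩))
    have hSE' : ∀ s ∈ S, s ∈ Earlier G l r (k + 1) a b := by
      intro s hs
      rcases hSE s hs with (rfl | rfl | ⟨j, hj, h | h⟩ | ⟨g1, g2, ⟨j, hj, h⟩ | ⟨j, hj, h⟩⟩) | h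
      · exact Or.inr (Or.inl rfl)
      · exact Or.inl rfl
      · exact Or.inr (Or.inr (Or.inl ⟨j, by omega, Or.inr h⟩))
      · exact Or.inr (Or.inr (Or.inl ⟨j, by omega, Or.inl h⟩))
      · exact Or.inr (Or.inr (Or.inr ⟨g2, g1, Or.inr ⟨j, by omega, h⟩⟩))
      · exact Or.inr (Or.inr (Or.inr ⟨g2, g1, Or.inl ⟨j, by omega, h⟩⟩))
      · exact Or.inr (Or.inr (Or.inl ⟨k, by omega, Or.inr h⟩))
    -- The vertices of the new component neither belong nor are adjacent to the graph so far.
    have hnew : ∀ v, ¬ Reach G l r k a b v → Btw l r v a b → ∀ s ∈ S, v ≠ s ∧ ¬ G.Adj v s := by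
      intro v hv hvB s hs
      have hvb := Reach.not_adj_of_btw hR hvB (.base 0 b a)
      have hleft : ∀ w, ∀ j ≤ k, Reach G l r j a b w → v ≠ w ∧ ¬ G.Adj v w := by
        intro w j hj h
        refine ⟨?_, fun hvw => hv (.adj (h.mono_le hj) hvw.symm hvb.1 hvb.2)⟩
        rintro rfl
        exact hv (h.mono_le hj)
      rcases hSE s hs with (rfl | rfl | ⟨j, hj, h | h⟩ | ⟨g1, g2, h⟩) | h
      · exact hvb
      · exact hleft _ k le_rfl (.base ..)
      · exact Reach.not_adj_of_btw hR hvB h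
      · exact hleft _ j hj.le h
      · refine ⟨?_, fun hvs => ?_⟩
        · rintro rfl
          exact hvb.2 g1
        · rcases h with ⟨j, hj, e', h, hn'⟩ | ⟨j, hj, e', h, hn'⟩
          · exact hn' (Reach.adj_of_not_reach hR hvB hv hvs.symm g1 (h.mono_le hj.le))
          · exact hv ((Reach.turn h g2 g1 hn' hvs.symm hvB).mono_le (by omega))
      · exact Reach.not_adj_of_btw hR hvB h
    have htS : t ∉ S := by
      intro hts
      by_cases htx : t = x
      · subst htx
        exact (hnew c₀ hc₀ hB t hts).2 htc₀.symm
      · exact hSx t hts htx (fun h => G.irrefl h)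
    have hq : ∀ v ∈ q.support, v ≠ t → ∀ s ∈ S, v ≠ s ∧ ¬ G.Adj v s := by
      intro v hv hvt
      have := (hp v (h4 v hv)).resolve_left hvt
      exact hnew v this.2.1 this.2.2
    refine ⟨c', _, h3, .succ (k + 1) S x a b hS c' t q ?_ h1 h2 ?_ hx ?_ ?_, ?_, ?_⟩
    · rintro rfl
      exact hD _ htE h3
    · intro v hv hvS
      by_cases hvt : v = t
      · exact htS (hvt ▸ hvS)
      · exact (hq v hv hvt v hvS).1 rfl
    · intro s hs hsx
      exact not_not.1 (hSx s hs hsx)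
    · intro v hv hvt s hs
      exact (hq v hv hvt s hs).2
    · rintro s (hs | hs) hsc
      · exact hD s (hSE' s hs)
      · exact h5 s hs hsc
    · rintro s (hs | hs)
      · exact Or.inl (hSE' s hs)
      · rcases hp s (h4 s hs) with rfl | h
        · exact Or.inl htE
        · exact Or.inr h.1

/-- A vertex that is reached on the side of `z` is the vertex `x_k` of a graph `H_k` with
`y_k = y` and `z_k = z`. -/
theorem Reach.exists_fatGraph (hR : IsRep G l r) {k : ℕ} {x y z : V} (hxy : x ≠ y) (hxz : x ≠ z)
    (hyz : y ≠ z) (nxy : ¬ G.Adj x y) (nyz : ¬ G.Adj y z) (hB : Btw l r x z y)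
    (h : Reach G l r k z y x) : ∃ (m : ℕ) (S : Set V), 1 ≤ m ∧ FATGraph G m S x y z := by
  classical
  have hex : ∃ k, Reach G l r k z y x := ⟨k, h⟩
  have hD : ∀ v ∈ Earlier G l r (Nat.find hex) z y, ¬ v = x := by
    rintro v hv rfl
    rcases hv with h | h | ⟨j, hj, h | h⟩ | ⟨-, h, -⟩
    · exact hxz h
    · exact hxy h
    · exact Nat.find_min hex hj h
    · exact (Reach.not_adj_of_btw hR hB h).1 rfl
    · exact nxy h
  obtain ⟨c, S, rfl, h1, -⟩ := exists_fatGraph_of_reach hR hyz.symm (fun h => nyz h.symm) hD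
    (Nat.find_spec hex) rfl
  exact ⟨_, S, Nat.succ_pos _, h1⟩

/-! ### Reflecting a part of a representation -/

/-- An interval `[p, q]` of the line can be reflected if every vertex whose interval meets it
without being contained in it is adjacent to all other vertices whose intervals meet it. -/
theorem IsRep.exists_flip (hR : IsRep G l r) {p q : ℝ} (hpq : p ≤ q)
    (h : ∀ v w, v ≠ w → l v ≤ q → p ≤ r v → ¬ (p ≤ l v ∧ r v ≤ q) → l w ≤ q → p ≤ r w →
      G.Adj v w) :
    ∃ l' r' : V → ℝ, IsRep G l' r' ∧ (∀ v, r v < p → l' v = l v ∧ r' v = r v) ∧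
      ∀ v, p ≤ l v → r v ≤ q → l' v = p + q - r v ∧ r' v = p + q - l v := by
  classical
  let In : V → Prop := fun v => p ≤ l v ∧ r v ≤ q
  let Out : V → Prop := fun v => r v < p ∨ q < l v
  let l' : V → ℝ := fun v => if Out v then l v else if In v then p + q - r v else min (l v) p
  let r' : V → ℝ := fun v => if Out v then r v else if In v then p + q - l v else max (r v) q
  have hout : ∀ v, Out v → l' v = l v ∧ r' v = r v := fun v hv => by simp [l', r', hv]
  have hin : ∀ v, In v → l' v = p + q - r v ∧ r' v = p + q - l v := fun v hv => by
    have : ¬ Out v := by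
      have := hR.le v
      rintro (h | h)
      · linarith [hv.1]
      · linarith [hv.2]
    simp [l', r', hv, this]
  have hcr : ∀ v, ¬ Out v → ¬ In v → l' v = min (l v) p ∧ r' v = max (r v) q := fun v hv hv' => by
    simp [l', r', hv, hv']
  refine ⟨l', r', ⟨fun v => ?_, ?_⟩, fun v hv => hout v (Or.inl hv), fun v h1 h2 => hin v ⟨h1, h2⟩⟩
  · have := hR.le v
    by_cases h1 : Out v
    · rw [(hout v h1).1, (hout v h1).2]; exact this
    · by_cases h2 : In v
      · rw [(hin v h2).1, (hin v h2).2]; linarith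
      · rw [(hcr v h1 h2).1, (hcr v h1 h2).2]
        exact (min_le_left _ _).trans (this.trans (le_max_left _ _))
  · -- Vertices are drawn outside of `[p, q]`, inside of it, or across one of its endpoints. By
    -- symmetry, each two kinds need to be compared in one order only.
    have houtin : ∀ v w, v ≠ w → Out v → In w → (G.Adj v w ↔ l' v ≤ r' w ∧ l' w ≤ r' v) := by
      intro v w hvw hv hw
      rw [hR.adj_iff v w hvw, (hout v hv).1, (hout v hv).2, (hin w hw).1, (hin w hw).2]
      have := hR.le v
      have := hR.le w
      obtain ⟨h1, h2⟩ := hw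
      rcases hv with hv | hv <;> constructor <;> rintro ⟨h3, h4⟩ <;> constructor <;> linarith
    have houtcr : ∀ v w, v ≠ w → Out v → ¬ Out w → ¬ In w →
        (G.Adj v w ↔ l' v ≤ r' w ∧ l' w ≤ r' v) := by
      intro v w hvw hv hw hw'
      rw [hR.adj_iff v w hvw, (hout v hv).1, (hout v hv).2, (hcr w hw hw').1, (hcr w hw hw').2]
      have := hR.le v
      have := hR.le w
      have hw1 : p ≤ r w := not_lt.1 fun h => hw (Or.inl h)
      have hw2 : l w ≤ q := not_lt.1 fun h => hw (Or.inr h)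
      rw [le_max_iff, min_le_iff]
      rcases hv with hv | hv
      · constructor
        · rintro ⟨h3, h4⟩
          exact ⟨Or.inl h3, Or.inl h4⟩
        · rintro ⟨-, h4 | h4⟩
          · exact ⟨by linarith, h4⟩
          · linarith
      · constructor
        · rintro ⟨h3, h4⟩
          exact ⟨Or.inl h3, Or.inl h4⟩
        · rintro ⟨h4 | h4, -⟩
          · exact ⟨h4, by linarith⟩
          · linarith
    have hcrmeet : ∀ v w, v ≠ w → ¬ Out v → ¬ In v → ¬ Out w →
        (G.Adj v w ↔ l' v ≤ r' w ∧ l' w ≤ r' v) := by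
      intro v w hvw hv hv' hw
      have hw1 : p ≤ r w := not_lt.1 fun h => hw (Or.inl h)
      have hw2 : l w ≤ q := not_lt.1 fun h => hw (Or.inr h)
      have hadj := h v w hvw (not_lt.1 fun h => hv (Or.inr h)) (not_lt.1 fun h => hv (Or.inl h))
        hv' hw2 hw1
      refine ⟨fun _ => ?_, fun _ => hadj⟩
      rw [(hcr v hv hv').1, (hcr v hv hv').2, min_le_iff, le_max_iff]
      by_cases hw' : In w
      · rw [(hin w hw').1, (hin w hw').2]
        have := hw'.1
        have := hw'.2
        exact ⟨Or.inr (by linarith), Or.inr (by linarith)⟩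
      · rw [(hcr w hw hw').1, (hcr w hw hw').2]
        exact ⟨Or.inr (hpq.trans (le_max_right _ _)), Or.inr ((min_le_right _ _).trans hpq)⟩
    have hsymm : ∀ v w, (G.Adj w v ↔ l' w ≤ r' v ∧ l' v ≤ r' w) →
        (G.Adj v w ↔ l' v ≤ r' w ∧ l' w ≤ r' v) := by
      intro v w h
      rw [SimpleGraph.adj_comm, h]
      exact and_comm
    intro v w hvw
    by_cases hv : Out v
    · by_cases hw : Out w
      · rw [hR.adj_iff v w hvw, (hout v hv).1, (hout v hv).2, (hout w hw).1, (hout w hw).2]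
      · by_cases hw' : In w
        · exact houtin v w hvw hv hw'
        · exact houtcr v w hvw hv hw hw'
    · by_cases hv' : In v
      · by_cases hw : Out w
        · exact hsymm _ _ (houtin w v hvw.symm hw hv')
        · by_cases hw' : In w
          · rw [hR.adj_iff v w hvw, (hin v hv').1, (hin v hv').2, (hin w hw').1, (hin w hw').2]
            constructor <;> rintro ⟨h3, h4⟩ <;> constructor <;> linarith
          · exact hsymm _ _ (hcrmeet w v hvw.symm hw hw' hv)
      · by_cases hw : Out w
        · exact hsymm _ _ (houtcr w v hvw.symm hw hv hv')
        · exact hcrmeet v w hvw hv hv' hw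

/-- In every representation of `G`, the vertex `z` is drawn between `x` and `y`. -/
def Forced (G : SimpleGraph V) (x z y : V) : Prop :=
  ∀ l r : V → ℝ, IsRep G l r → Btw l r x z y

theorem Forced.symm {x z y : V} (h : Forced G x z y) : Forced G y z x :=
  fun l r hR => (h l r hR).symm

/-- A part of a representation that contains `z` and `y`, but not `x`, cannot be reflected. -/
theorem Forced.not_flip {x z y : V} (hF : Forced G x z y) (hR : IsRep G l r) {p q : ℝ}
    (h : ∀ v w, v ≠ w → l v ≤ q → p ≤ r v → ¬ (p ≤ l v ∧ r v ≤ q) → l w ≤ q → p ≤ r w →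
      G.Adj v w) (hx : r x < p) (hz : p ≤ l z) (hzy : r z < l y) (hy : r y ≤ q) : False := by
  have h1 := hR.le z
  have h2 := hR.le y
  obtain ⟨l', r', hR', hx', hin⟩ := hR.exists_flip (by linarith) h
  have g1 := hx' x hx
  have g2 := hin z hz (by linarith)
  have g3 := hin y (by linarith) hy
  have := hR'.le x
  rcases hF l' r' hR' with ⟨h3, h4⟩ | ⟨h3, h4⟩ <;> linarith

/-- An unreached vertex beyond `z` lies beyond all reached vertices on the side of `z` and
beyond all common neighbours of `z` and `y` that can be used in a turn on that side. -/
theorem lt_of_forall_not_reach (hR : IsRep G l r) {v z y m : V} (hvz : r v < l z)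
    (hzy : r z < l y) (hv : ∀ k, ¬ Reach G l r k z y v)
    (hm : (∃ k, Reach G l r k z y m) ∨
      (G.Adj m z ∧ G.Adj m y ∧ ∃ k e, Reach G l r k y z e ∧ ¬ G.Adj m e)) : r v < l m := by
  rcases hm with ⟨k, hm⟩ | ⟨h1, h2, k, e, he, hn⟩
  · exact Reach.lt_of_not_reach hR hvz hzy (hv k) hm
  · refine hR.lt_of_adj hvz h1.symm ?_ ?_
    · rintro rfl
      exact (hR.not_adj_of_lt (v := v) (w := y) (by linarith [hR.le z])).2 h2
    · exact fun h => hv (k + 1) (.turn he h1 h2 hn h.symm (Or.inl ⟨hvz, hzy⟩))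

/-- If `z` has to be drawn between `x` and `y`, then alternating paths force `x` to the side of
`z`. Otherwise everything reached on the sides of `z` and `y` could be reflected. -/
theorem Forced.exists_reach [Finite V] {x z y : V} (hF : Forced G x z y) (hR : IsRep G l r) :
    ∃ k, Reach G l r k z y x := by
  have key : ∀ {l r : V → ℝ}, IsRep G l r → r x < l z → r z < l y → ∃ k, Reach G l r k z y x := by
    intro l r hR hxz hzy
    by_contra hx
    push Not at hx
    let A : V → V → Set V := fun z y => {m | (∃ k, Reach G l r k z y m) ∨
      (G.Adj m z ∧ G.Adj m y ∧ ∃ k e, Reach G l r k y z e ∧ ¬ G.Adj m e)}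
    obtain ⟨p, hp, hpmin⟩ := Set.exists_min_image (A z y) l (Set.toFinite _)
      ⟨z, Or.inl ⟨0, .base ..⟩⟩
    obtain ⟨q, hq, hqmax⟩ := Set.exists_max_image (A y z) r (Set.toFinite _)
      ⟨y, Or.inl ⟨0, .base ..⟩⟩
    have hpz : l p ≤ l z := hpmin z (Or.inl ⟨0, .base ..⟩)
    have hqy : r y ≤ r q := hqmax y (Or.inl ⟨0, .base ..⟩)
    have hleft : ∀ v, r v < l z → (∀ k, ¬ Reach G l r k z y v) → r v < l p :=
      fun v h1 h2 => lt_of_forall_not_reach hR h1 hzy h2 hp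
    have hright : ∀ v, r y < l v → (∀ k, ¬ Reach G l r k y z v) → r q < l v := by
      intro v h1 h2
      have := lt_of_forall_not_reach hR.reflect (v := v) (z := y) (y := z) (m := q)
        (neg_lt_neg h1) (neg_lt_neg hzy) (fun k => by rw [Reach.reflect_iff]; exact h2 k)
        (by simp only [Reach.reflect_iff]; exact hq)
      simpa using this
    have hz := hR.le z
    have hy := hR.le y
    -- An interval leaving the reflected part on the left sees `z`, `y` and all of that part.
    have hL : ∀ v, l v < l p → l p ≤ r v → G.Adj v z ∧ G.Adj v y ∧
        ∀ w, v ≠ w → l p ≤ l w → r w ≤ r q → G.Adj v w := by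
      intro v h1 h2
      have hvA : v ∉ A z y := fun h => absurd (hpmin v h) (not_le.2 h1)
      have hvr : ∀ k, ¬ Reach G l r k z y v := fun k h => hvA (Or.inl ⟨k, h⟩)
      have hvy : v ≠ y := by rintro rfl; linarith
      have nvy : G.Adj v y := by
        by_contra nvy
        have h3 : r v < l y := (hR.lt_or_lt hvy nvy).resolve_right (by linarith)
        by_cases h4 : r v < l z
        · linarith [hleft v h4 hvr]
        · rcases hR.adj_or_eq (v := v) (w := z) (by linarith) (by linarith) with rfl | h5
          · linarith
          · exact hvr 0 (.adj (.base ..) h5.symm hvy nvy)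
      have h3 := hR.adj_le nvy
      have nvz : G.Adj v z := by
        rcases hR.adj_or_eq (v := v) (w := z) (by linarith) (by linarith) with rfl | h5
        · linarith
        · exact h5
      have hall : ∀ k e, Reach G l r k y z e → G.Adj v e := fun k e he => by
        by_contra hn
        exact hvA (Or.inr ⟨nvz, nvy, k, e, he, hn⟩)
      refine ⟨nvz, nvy, fun w hvw h4 h5 => ?_⟩
      by_contra nvw
      have h6 : r v < l w := (hR.lt_or_lt hvw nvw).resolve_right (by linarith [hR.le w])
      have h7 := hR.not_adj_of_lt (v := z) (w := w) (by linarith)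
      have h8 : ∀ k, ¬ Reach G l r k y z w := fun k hk => nvw (hall k w hk)
      by_cases h9 : r y < l w
      · linarith [hright w h9 h8, hR.le w]
      · rcases hR.adj_or_eq (v := y) (w := w) (by linarith [hR.le w]) (by linarith) with rfl | h10
        · exact h8 0 (.base ..)
        · exact h8 0 (.adj (.base ..) h10 h7.1.symm fun h => h7.2 h.symm)
    have hRt : ∀ v, r q < r v → l v ≤ r q → G.Adj v z ∧ G.Adj v y ∧
        ∀ w, v ≠ w → l p ≤ l w → r w ≤ r q → G.Adj v w := by
      intro v h1 h2
      have hvA : v ∉ A y z := fun h => absurd (hqmax v h) (not_le.2 h1)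
      have hvr : ∀ k, ¬ Reach G l r k y z v := fun k h => hvA (Or.inl ⟨k, h⟩)
      have hvz : v ≠ z := by rintro rfl; linarith
      have nvz : G.Adj v z := by
        by_contra nvz
        have h3 : r z < l v := (hR.lt_or_lt hvz nvz).resolve_left (by linarith)
        by_cases h4 : r y < l v
        · linarith [hright v h4 hvr]
        · rcases hR.adj_or_eq (v := v) (w := y) (by linarith) (by linarith) with rfl | h5
          · linarith
          · exact hvr 0 (.adj (.base ..) h5.symm hvz nvz)
      have h3 := hR.adj_le nvz
      have nvy : G.Adj v y := by
        rcases hR.adj_or_eq (v := v) (w := y) (by linarith) (by linarith) with rfl | h5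
        · linarith
        · exact h5
      have hall : ∀ k e, Reach G l r k z y e → G.Adj v e := fun k e he => by
        by_contra hn
        exact hvA (Or.inr ⟨nvy, nvz, k, e, he, hn⟩)
      refine ⟨nvz, nvy, fun w hvw h4 h5 => ?_⟩
      by_contra nvw
      have h6 : r w < l v := (hR.lt_or_lt hvw nvw).resolve_left (by linarith [hR.le w])
      have h7 := hR.not_adj_of_lt (v := w) (w := y) (by linarith)
      have h8 : ∀ k, ¬ Reach G l r k z y w := fun k hk => nvw (hall k w hk)
      by_cases h9 : r w < l z
      · linarith [hleft w h9 h8, hR.le w]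
      · rcases hR.adj_or_eq (v := z) (w := w) (by linarith) (by linarith [hR.le w]) with rfl | h10
        · exact h8 0 (.base ..)
        · exact h8 0 (.adj (.base ..) h10 h7.1 h7.2)
    have hcross : ∀ v, l v ≤ r q → l p ≤ r v → ¬ (l p ≤ l v ∧ r v ≤ r q) → G.Adj v z ∧ G.Adj v y ∧
        ∀ w, v ≠ w → l p ≤ l w → r w ≤ r q → G.Adj v w := by
      intro v h1 h2 h3
      by_cases h4 : l v < l p
      · exact hL v h4 h2
      · exact hRt v (by by_contra h5; exact h3 ⟨by linarith, by linarith⟩) h1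
    have hzy' := hR.not_adj_of_lt hzy
    refine hF.not_flip hR (p := l p) (q := r q) ?_ (hleft x hxz hx) hpz hzy hqy
    intro v w hvw h1 h2 h3 h4 h5
    obtain ⟨g1, g2, g3⟩ := hcross v h1 h2 h3
    by_cases h6 : l p ≤ l w ∧ r w ≤ r q
    · exact g3 w hvw h6.1 h6.2
    · obtain ⟨g4, g5, -⟩ := hcross w h4 h5 h6
      exact (hR.common_adj hzy'.1 hzy'.2 g1 g2 g4 g5).resolve_left hvw
  rcases hF l r hR with ⟨h1, h2⟩ | ⟨h1, h2⟩
  · exact key hR h1 h2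
  · obtain ⟨k, hk⟩ := key hR.reflect (neg_lt_neg h2) (neg_lt_neg h1)
    exact ⟨k, Reach.reflect_iff.1 hk⟩

/-! ### The graphs of `k`-FAT obstructions -/

namespace FATGraph

variable {k : ℕ} {S : Set V} {x y z : V}

theorem mem (h : FATGraph G k S x y z) : x ∈ S ∧ y ∈ S ∧ z ∈ S := by
  induction h with
  | one x y z p =>
    exact ⟨Or.inr p.start_mem_support, Or.inl rfl, Or.inr p.end_mem_support⟩
  | succ k S x y z h x' t p _ _ _ _ _ _ _ ih =>
    exact ⟨Or.inr p.start_mem_support, Or.inl ih.2.2, Or.inl ih.2.1⟩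

theorem ne_and_not_adj (h : FATGraph G k S x y z) :
    (x ≠ y ∧ x ≠ z ∧ y ≠ z) ∧ ¬ G.Adj x y ∧ ¬ G.Adj y z := by
  induction h with
  | one x y z p hxz _ _ hy =>
    have h1 := hy x p.start_mem_support
    have h2 := hy z p.end_mem_support
    exact ⟨⟨h1.1, hxz, h2.1.symm⟩, h1.2, fun h => h2.2 h.symm⟩
  | succ k S x y z h x' t p hxt _ _ hdisj _ _ hnadj ih =>
    have hx' := hdisj x' p.start_mem_support
    obtain ⟨-, hy, hz⟩ := h.mem
    refine ⟨⟨?_, ?_, ih.1.2.2.symm⟩, hnadj x' p.start_mem_support hxt z hz, fun h => ih.2.2 h.symm⟩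
    · rintro rfl; exact hx' hz
    · rintro rfl; exact hx' hy

theorem exists_walk (h : FATGraph G k S x y z) : ∃ p : G.Walk x z, ∀ v ∈ p.support, v ∈ S := by
  induction h with
  | one x y z p => exact ⟨p, fun v hv => Or.inr hv⟩
  | succ k S x y z h x' t p _ _ _ _ _ ht _ _ =>
    have hy := h.mem.2.1
    refine ⟨p.append (ht y hy h.ne_and_not_adj.1.1.symm).toWalk, fun v hv => ?_⟩
    rw [SimpleGraph.Walk.mem_support_append_iff] at hv
    rcases hv with hv | hv
    · exact Or.inr hv
    · rw [SimpleGraph.Adj.support_toWalk] at hv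
      simp only [List.mem_cons, List.not_mem_nil, or_false] at hv
      rcases hv with rfl | rfl
      · exact Or.inr p.end_mem_support
      · exact Or.inl hy

end FATGraph

/-- A walk that avoids the closed neighbourhood of `q` stays on one side of `q`. -/
theorem IsRep.lt_of_walk (hR : IsRep G l r) {a b q : V} (p : G.Walk a b)
    (h : ∀ v ∈ p.support, v ≠ q ∧ ¬ G.Adj v q) (ha : r a < l q) : r b < l q := by
  induction p with
  | nil => exact ha
  | @cons a b c hab p ih =>
    have hb := h b (by simp)
    exact ih (fun v hv => h v (by simp [hv]))
      (hR.gt_of_adj ha hab hb.1.symm fun h => hb.2 h.symm)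

theorem IsRep.not_btw_of_walk (hR : IsRep G l r) {a b q : V} (p : G.Walk a b)
    (h : ∀ v ∈ p.support, v ≠ q ∧ ¬ G.Adj v q) : ¬ Btw l r a q b := by
  have := hR.le q
  rintro (⟨h1, h2⟩ | ⟨h1, h2⟩)
  · have := hR.lt_of_walk p h h1
    linarith [hR.le b]
  · have := hR.lt_of_walk p.reverse (by simpa using h) h1
    linarith [hR.le a]

/-- The property for which the graphs `H_k` are made: no representation draws `y_k` between
`x_k` and `z_k`. -/
theorem FATGraph.not_btw {k : ℕ} {S : Set V} {x y z : V} (h : FATGraph G k S x y z) :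
    ∀ {l r : V → ℝ}, IsRep G l r → ¬ Btw l r x y z := by
  induction h with
  | one x y z p _ _ _ hy => exact fun hR => hR.not_btw_of_walk p hy
  | succ k S x y z h x' t p hxt _ _ hdisj hx ht hnadj ih =>
    obtain ⟨hxS, hyS, hzS⟩ := h.mem
    obtain ⟨⟨hxy, hxz, hyz⟩, nxy, nyz⟩ := h.ne_and_not_adj
    have hx'S := hdisj x' p.start_mem_support
    have key : ∀ {l r : V → ℝ}, IsRep G l r → r x' < l z → r z < l y → False := by
      intro l r hR h1 h2
      have hty := hR.adj_le (ht y hyS hxy.symm)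
      have htz := hR.adj_le (ht z hzS hxz.symm)
      have htx : t ≠ x := by
        rintro rfl
        exact hdisj t p.end_mem_support hxS
      have hxx' : x' ≠ x := by rintro rfl; exact hx'S hxS
      rcases hR.lt_or_lt htx hx with h3 | h3
      · have h4 : r y < l x := (hR.lt_or_lt hxy nxy).resolve_left (by linarith [hR.le x])
        exact ih hR (Or.inr ⟨h2, h4⟩)
      · rcases hR.lt_or_lt hxx' (hnadj x' p.start_mem_support hxt x hxS) with h4 | h4
        · refine hR.not_btw_of_walk p (fun v hv => ⟨?_, ?_⟩) (Or.inl ⟨h4, h3⟩)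
          · rintro rfl; exact hdisj v hv hxS
          · by_cases hvt : v = t
            · rw [hvt]; exact hx
            · exact hnadj v hv hvt x hxS
        · obtain ⟨w, hw⟩ := h.exists_walk
          refine hR.not_btw_of_walk w (fun v hv => ⟨?_, fun hvx => ?_⟩) (Or.inl ⟨h4, h1⟩)
          · rintro rfl; exact hx'S (hw v hv)
          · exact hnadj x' p.start_mem_support hxt v (hw v hv) hvx.symm
    rintro l r hR (⟨h1, h2⟩ | ⟨h1, h2⟩)
    · exact key hR h1 h2
    · exact key hR.reflect (neg_lt_neg h2) (neg_lt_neg h1)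

/-! ### Modules -/

/-- A set of vertices is a module if every vertex outside that is adjacent to one of its elements
is adjacent to all of them. -/
def IsModule (G : SimpleGraph V) (M : Set V) : Prop :=
  ∀ v ∉ M, ∀ m ∈ M, G.Adj v m → ∀ m' ∈ M, G.Adj v m'

theorem IsModule.walk_subset {M : Set V} (hM : IsModule G M) {a t m : V} (p : G.Walk a t)
    (ht : t ∈ M) (hm : m ∈ M) (h : ∀ v ∈ p.support, v = t ∨ ¬ G.Adj v m) :
    ∀ v ∈ p.support, v ∈ M := by
  induction p with
  | nil =>
    intro v hv
    rw [SimpleGraph.Walk.support_nil, List.mem_singleton] at hv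
    exact hv ▸ ht
  | @cons a b c hab p ih =>
    have hp := ih ht fun v hv => h v (by simp [hv])
    intro v hv
    rw [SimpleGraph.Walk.support_cons, List.mem_cons] at hv
    rcases hv with rfl | hv
    · by_contra hvM
      rcases h v (by simp) with rfl | hn
      · exact hvM ht
      · exact hn (hM v hvM b (hp b p.start_mem_support) hab m hm)
    · exact hp v hv

theorem FATGraph.subset_module {k : ℕ} {S M : Set V} {x y z : V} (h : FATGraph G k S x y z)
    (hM : IsModule G M) (hy : y ∈ M) (hz : z ∈ M) : S ⊆ M := by
  induction h with
  | one x y z p _ _ _ hp =>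
    rintro v (rfl | hv)
    · exact hy
    · exact hM.walk_subset p hz hy (fun v hv => Or.inr (hp v hv).2) v hv
  | succ k S x y z h x' t p _ _ _ _ hx ht hnadj ih =>
    have hS := ih hz hy
    have htM : t ∈ M := by
      by_contra htM
      have := ht z h.mem.2.2 h.ne_and_not_adj.1.2.1.symm
      exact hx (hM t htM z hy this x (hS h.mem.1))
    rintro v (hv | hv)
    · exact hS hv
    · refine hM.walk_subset p htM hz (fun v hv => ?_) v hv
      by_cases hvt : v = t
      · exact Or.inl hvt
      · exact Or.inr (hnadj v hv hvt y h.mem.2.1)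

/-! ### The two graphs of a covered endpoint obstruction -/

theorem Reach.of_walk {a b c : V} (p : G.Walk a c) (h : ∀ v ∈ p.support, v ≠ b ∧ ¬ G.Adj v b) :
    Reach G l r 0 a b c := by
  have key : ∀ {a' c' : V} (p : G.Walk a' c'), Reach G l r 0 a b a' →
      (∀ v ∈ p.support, v ≠ b ∧ ¬ G.Adj v b) → Reach G l r 0 a b c' := by
    intro a' c' p
    induction p with
    | nil => exact fun h _ => h
    | @cons u v w huv p ih =>
      intro h1 h2
      have := h2 v (by simp)
      exact ih (.adj h1 huv this.1 this.2) fun v hv => h2 v (by simp [hv])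
  exact key p (.base ..) h

theorem Reach.symm_zero {a b c : V} (hab : a ≠ b) (nab : ¬ G.Adj a b)
    (h : Reach G l r 0 a b c) : Reach G l r 0 c b a := by
  obtain ⟨p, hp⟩ := h.exists_walk_zero hab nab
  exact .of_walk p fun v hv => (hp v hv).2

/-- The component of `a` without the closed neighbourhood of `b` does not extend past a vertex that
is not adjacent to `b` and does not belong to the component. -/
theorem Reach.lt_of_zero (hR : IsRep G l r) {a b c d : V} (hac : r a < l c) (hcb : c ≠ b)
    (ncb : ¬ G.Adj c b) (hc : ¬ Reach G l r 0 a b c) (hab : a ≠ b) (nab : ¬ G.Adj a b)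
    (hd : Reach G l r 0 a b d) : r d < l c := by
  obtain ⟨p, hp⟩ := hd.exists_walk_zero hab nab
  refine hR.lt_of_walk p.reverse (fun v hv => ?_) hac
  have hv := (hp v (by simpa using hv)).1
  refine ⟨?_, fun h => hc (.adj hv h hcb ncb)⟩
  rintro rfl
  exact hc hv

theorem Reach.gt_of_zero (hR : IsRep G l r) {a b c d : V} (hac : r c < l a) (hcb : c ≠ b)
    (ncb : ¬ G.Adj c b) (hc : ¬ Reach G l r 0 a b c) (hab : a ≠ b) (nab : ¬ G.Adj a b)
    (hd : Reach G l r 0 a b d) : r c < l d := by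
  have := Reach.lt_of_zero hR.reflect (neg_lt_neg hac) hcb ncb (by rwa [reflect_iff]) hab nab
    hd.reflect
  simpa using this

/-- Let `z` be forced between `x` and `y`, and suppose that the closed neighbourhood of `y`
separates `x` from `z` and that of `x` separates `y` from `z`. Then some common neighbour of `x`
and `z` sees some, but not all, of the component of `y` in the graph without the closed
neighbourhood of `x`: otherwise this component could be reflected together with everything
between it and the component of `x`. If `x'` and `y'` are the vertices of the two components that
come closest to `z`, this gives a graph `H_2`. -/
theorem Forced.exists_fatGraph_two [Finite V] {x y z x' y' : V} (hF : Forced G x z y)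
    (hR : IsRep G l r) (hxz : r x < l z) (hzy : r z < l y)
    (hx : ¬ Reach G l r 0 z y x) (hy : ¬ Reach G l r 0 z x y)
    (hx' : Reach G l r 0 x y x') (hxmax : ∀ v, Reach G l r 0 x y v → r v ≤ r x')
    (hy' : Reach G l r 0 y x y') (hymin : ∀ v, Reach G l r 0 y x v → l y' ≤ l v) :
    ∃ S, FATGraph G 2 S x' y' z := by
  have lz := hR.le z
  have dzy := hR.not_adj_of_lt hzy
  have dxz := hR.not_adj_of_lt hxz
  have dxy := hR.not_adj_of_lt (v := x) (w := y) (by linarith)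
  have nzx : ¬ G.Adj z x := fun h => dxz.2 h.symm
  have nyx : ¬ G.Adj y x := fun h => dxy.2 h.symm
  have hCx : ∀ v, Reach G l r 0 x y v → r v < l z := fun v hv =>
    Reach.lt_of_zero hR hxz dzy.1 dzy.2 (fun h => hx (h.symm_zero dxy.1 dxy.2)) dxy.1 dxy.2 hv
  have hCy : ∀ v, Reach G l r 0 y x v → r z < l v := fun v hv =>
    Reach.gt_of_zero hR hzy dxz.1.symm nzx (fun h => hy (h.symm_zero dxy.1.symm nyx))
      dxy.1.symm nyx hv
  have hxx' : r x ≤ r x' := hxmax x (.base ..)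
  have hx'z := hCx x' hx'
  have hzy' := hCy y' hy'
  have hy'y : l y' ≤ l y := hymin y (.base ..)
  have hsplit : ∃ t d₀ d₁, ¬ Reach G l r 0 y x t ∧ Reach G l r 0 y x d₀ ∧ G.Adj t d₀ ∧
      Reach G l r 0 y x d₁ ∧ ¬ G.Adj t d₁ := by
    by_contra hno
    have hno : ∀ t, ¬ Reach G l r 0 y x t → ∀ d₀, Reach G l r 0 y x d₀ → G.Adj t d₀ →
        ∀ d₁, Reach G l r 0 y x d₁ → G.Adj t d₁ := by
      intro t h1 d₀ h2 h3 d₁ h4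
      by_contra h5
      exact hno ⟨t, d₀, d₁, h1, h2, h3, h4, h5⟩
    obtain ⟨p, hp, hpmin⟩ := Set.exists_min_image {v | r x' < l v} l (Set.toFinite _)
      ⟨z, hx'z⟩
    obtain ⟨q, hq, hqmax⟩ := Set.exists_max_image {v | Reach G l r 0 y x v} r (Set.toFinite _)
      ⟨y, .base ..⟩
    have hp : r x' < l p := hp
    have hpz : l p ≤ l z := hpmin z hx'z
    have hq : Reach G l r 0 y x q := hq
    have hyq : r y ≤ r q := hqmax y (.base ..)
    have hcross : ∀ v, l v ≤ r q → l p ≤ r v → ¬ (l p ≤ l v ∧ r v ≤ r q) →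
        l v < l p ∧ ∀ d, Reach G l r 0 y x d → G.Adj v d := by
      intro v h1 h2 h3
      have hlt : l v < l p := by
        by_contra h4
        have h5 : r q < r v := by
          by_contra h5
          exact h3 ⟨not_lt.1 h4, not_lt.1 h5⟩
        have h6 : ¬ Reach G l r 0 y x v := fun h => absurd (hqmax v h) (not_le.2 h5)
        have h7 := hR.not_adj_of_lt (v := x) (w := v) (by linarith)
        rcases hR.adj_or_eq (v := q) (w := v) (by linarith [hR.le q]) h1 with rfl | h8
        · exact h6 hq
        · exact h6 (.adj hq h8 h7.1.symm fun h => h7.2 h.symm)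
      refine ⟨hlt, ?_⟩
      have h4 : l v ≤ r x' := by
        by_contra h4
        exact absurd (hpmin v (not_le.1 h4)) (not_le.2 hlt)
      have h5 : ¬ Reach G l r 0 x y v := fun h => by linarith [hxmax v h]
      have h6 : G.Adj v y := by
        by_contra h6
        rcases hR.adj_or_eq (v := x') (w := v) (by linarith [hR.le x']) h4 with rfl | h7
        · exact h5 hx'
        · refine h5 (.adj hx' h7 ?_ h6)
          rintro rfl
          linarith
      exact hno v (fun h => by linarith [hCy v h]) y (.base ..) h6
    refine hF.not_flip hR (p := l p) (q := r q) ?_ (by linarith) hpz hzy hyq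
    intro v w hvw h1 h2 h3 h4 h5
    obtain ⟨h6, h7⟩ := hcross v h1 h2 h3
    by_contra nvw
    by_cases h8 : l p ≤ l w ∧ r w ≤ r q
    · have h9 : r v < l w := (hR.lt_or_lt hvw nvw).resolve_right (by linarith [hR.le w])
      have h10 := hR.adj_le (h7 y (.base ..))
      have h11 : ¬ Reach G l r 0 y x w := fun h => nvw (h7 w h)
      have h12 := hR.not_adj_of_lt (v := x) (w := w) (by linarith)
      have nwx : ¬ G.Adj w x := fun h => h12.2 h.symm
      have h13 : r y < l w := by
        by_contra h13
        rcases hR.adj_or_eq (v := y) (w := w) (by linarith [hR.le w]) (not_lt.1 h13) with rfl | h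
        · exact h11 (.base ..)
        · exact h11 (.adj (.base ..) h h12.1.symm nwx)
      have := Reach.lt_of_zero hR h13 h12.1.symm nwx h11 dxy.1.symm nyx hq
      linarith [hR.le w]
    · have := (hcross w h4 h5 h8).1
      exact (hR.adj_or_eq (v := v) (w := w) (by linarith) (by linarith)).elim hvw nvw
  obtain ⟨t, d₀, d₁, ht, hd₀, htd₀, hd₁, htd₁⟩ := hsplit
  have htx : G.Adj t x := by
    by_contra h
    refine ht (.adj hd₀ htd₀.symm ?_ h)
    rintro rfl
    obtain ⟨w, hw⟩ := hd₀.exists_walk_zero dxy.1.symm nyx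
    exact (hw d₀ w.start_mem_support).2.2 htd₀.symm
  have g1 := (hR.adj_le htx).1
  have g2 : l y' ≤ r t := (hymin d₀ hd₀).trans (hR.adj_le htd₀).2
  have htx' : G.Adj x' t := by
    rcases hR.adj_or_eq (v := x') (w := t) (by linarith [hR.le x']) (by linarith) with rfl | h
    · linarith
    · exact h
  have hty' : G.Adj t y' := by
    rcases hR.adj_or_eq (v := t) (w := y') (by linarith [hR.le y']) g2 with rfl | h
    · exact absurd hy' ht
    · exact h
  have htz : G.Adj t z := by
    rcases hR.adj_or_eq (v := t) (w := z) (by linarith) (by linarith) with rfl | h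
    · exact absurd htx nzx
    · exact h
  have hwalk : ∃ p : G.Walk d₁ y', ∀ v ∈ p.support, Reach G l r 0 y x v := by
    obtain ⟨p₁, hp₁⟩ := hd₁.exists_walk_zero dxy.1.symm nyx
    obtain ⟨p₂, hp₂⟩ := hy'.exists_walk_zero dxy.1.symm nyx
    refine ⟨p₁.append p₂.reverse, fun v hv => ?_⟩
    rw [SimpleGraph.Walk.mem_support_append_iff] at hv
    rcases hv with hv | hv
    · exact (hp₁ v hv).1
    · exact (hp₂ v (by simpa using hv)).1
  obtain ⟨p, hp⟩ := hwalk
  obtain ⟨c, q, h1, h2, h3, h4, h5⟩ := exists_chordless_path p (fun v => ¬ G.Adj t v)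
    ⟨d₁, p.start_mem_support, htd₁⟩
  have hqC : ∀ v ∈ q.support, Reach G l r 0 y x v := fun v hv => hp v (h4 v hv)
  have hqz : ∀ v ∈ q.support, v ≠ z ∧ ¬ G.Adj v z := fun v hv => by
    have := hR.not_adj_of_lt (hCy v (hqC v hv))
    exact ⟨this.1.symm, fun h => this.2 h.symm⟩
  have hx'q : ∀ v ∈ insert z {v | v ∈ q.support}, r x' < l v := by
    rintro v (rfl | hv)
    · exact hx'z
    · linarith [hCy v (hqC v hv)]
  have hcy : c ≠ y' := by rintro rfl; exact h3 hty'
  refine ⟨_, .succ 1 _ c z y' (.one c z y' q hcy h1 h2 hqz) x' t htx'.toWalk htx'.ne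
    ?_ htx'.isChordless_toWalk ?_ h3 ?_ ?_⟩
  · simp [SimpleGraph.Walk.isPath_def, htx'.ne]
  · intro v hv hvS
    rw [SimpleGraph.Adj.support_toWalk] at hv
    simp only [List.mem_cons, List.not_mem_nil, or_false] at hv
    rcases hv with rfl | rfl
    · linarith [hx'q v hvS, hR.le v]
    · rcases hvS with rfl | hvS
      · exact G.irrefl htz
      · exact ht (hqC v hvS)
  · rintro s (rfl | hs) hsc
    · exact htz
    · exact not_not.1 (h5 s hs hsc)
  · intro v hv hvt s hs
    rw [SimpleGraph.Adj.support_toWalk] at hv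
    simp only [List.mem_cons, List.not_mem_nil, or_false] at hv
    obtain rfl := hv.resolve_right hvt
    exact (hR.not_adj_of_lt (hx'q s hs)).2

/-- The two graphs `H_k` and `H'_ℓ`, within every module that contains `x`, `y` and `z`. The
vertices `x` and `y` may have to be replaced by other neighbours of `u`. -/
theorem Forced.exists_fatGraphs [Finite V] {x y z u : V} (hF : Forced G x z y)
    (hR : IsRep G l r) (hux : G.Adj u x) (huy : G.Adj u y) {M : Set V} (hM : IsModule G M)
    (hxM : x ∈ M) (hyM : y ∈ M) (hzM : z ∈ M) :
    ∃ (k m : ℕ) (x' y' : V) (S S' : Set V), ((1 ≤ k ∧ m = 1) ∨ (k = 2 ∧ m = 2)) ∧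
      FATGraph G k S x' y' z ∧ FATGraph G m S' y' x' z ∧ S ⊆ M ∧ S' ⊆ M ∧
      ¬ G.Adj x' z ∧ G.Adj u x' ∧ G.Adj u y' := by
  have key : ∀ {l r : V → ℝ}, IsRep G l r → r x < l z → r z < l y →
    ∃ (k m : ℕ) (x' y' : V) (S S' : Set V), ((1 ≤ k ∧ m = 1) ∨ (k = 2 ∧ m = 2)) ∧
      FATGraph G k S x' y' z ∧ FATGraph G m S' y' x' z ∧ S ⊆ M ∧ S' ⊆ M ∧
      ¬ G.Adj x' z ∧ G.Adj u x' ∧ G.Adj u y' := by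
    intro l r hR hxz hzy
    have lz := hR.le z
    have dzy := hR.not_adj_of_lt hzy
    have dxz := hR.not_adj_of_lt hxz
    have dxy := hR.not_adj_of_lt (v := x) (w := y) (by linarith)
    have nzx : ¬ G.Adj z x := fun h => dxz.2 h.symm
    have nyz : ¬ G.Adj y z := fun h => dzy.2 h.symm
    have nyx : ¬ G.Adj y x := fun h => dxy.2 h.symm
    -- One component that contains `z` gives a path and hence a graph `H_1`.
    have hone : ∀ {x y : V}, x ≠ z → z ≠ y → ¬ G.Adj z y → Reach G l r 0 z y x →
        ∃ S, FATGraph G 1 S x y z := by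
      intro x y hxz hzy nzy h
      obtain ⟨p, hp⟩ := h.exists_walk_zero hzy nzy
      obtain ⟨c, q, h1, h2, h3, h4, h5⟩ := exists_chordless_path p (fun v => v = x)
        ⟨x, p.start_mem_support, rfl⟩
      subst h3
      exact ⟨_, .one c y z q hxz h1 h2 fun v hv => (hp v (h4 v hv)).2⟩
    obtain ⟨i, hi⟩ := hF.exists_reach hR
    obtain ⟨j, hj⟩ := hF.symm.exists_reach hR
    obtain ⟨k, S, hk, hS⟩ := hi.exists_fatGraph hR dxy.1 dxz.1 dzy.1.symm dxy.2 nyz (hF l r hR)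
    obtain ⟨m, S', hm, hS'⟩ := hj.exists_fatGraph hR dxy.1.symm dzy.1.symm dxz.1 nyx dxz.2
      (hF.symm l r hR)
    by_cases hy : Reach G l r 0 z x y
    · obtain ⟨S', hS'⟩ := hone dzy.1.symm dxz.1.symm nzx hy
      exact ⟨k, 1, x, y, S, S', Or.inl ⟨hk, rfl⟩, hS, hS', hS.subset_module hM hyM hzM,
        hS'.subset_module hM hxM hzM, dxz.2, hux, huy⟩
    by_cases hx : Reach G l r 0 z y x
    · obtain ⟨S, hS⟩ := hone dxz.1 dzy.1 dzy.2 hx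
      exact ⟨m, 1, y, x, S', S, Or.inl ⟨hm, rfl⟩, hS', hS, hS'.subset_module hM hxM hzM,
        hS.subset_module hM hyM hzM, nyz, huy, hux⟩
    obtain ⟨x', hx', hxmax⟩ := Set.exists_max_image {v | Reach G l r 0 x y v} r (Set.toFinite _)
      ⟨x, .base ..⟩
    obtain ⟨y', hy', hymin⟩ := Set.exists_min_image {v | Reach G l r 0 y x v} l (Set.toFinite _)
      ⟨y, .base ..⟩
    have hx' : Reach G l r 0 x y x' := hx'
    have hy' : Reach G l r 0 y x y' := hy'
    obtain ⟨S, hS⟩ := hF.exists_fatGraph_two hR hxz hzy hx hy hx' hxmax hy' hymin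
    obtain ⟨S', hS'⟩ := hF.symm.exists_fatGraph_two hR.reflect (neg_lt_neg hzy) (neg_lt_neg hxz)
      (by rwa [Reach.reflect_iff]) (by rwa [Reach.reflect_iff]) hy'.reflect
      (fun v hv => neg_le_neg (hymin v (Reach.reflect_iff.1 hv))) hx'.reflect
      (fun v hv => neg_le_neg (hxmax v (Reach.reflect_iff.1 hv)))
    have hx'z : r x' < l z := Reach.lt_of_zero hR hxz dzy.1 dzy.2
      (fun h => hx (h.symm_zero dxy.1 dxy.2)) dxy.1 dxy.2 hx'
    have hzy' : r z < l y' := Reach.gt_of_zero hR hzy dxz.1.symm nzx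
      (fun h => hy (h.symm_zero dxy.1.symm nyx)) dxy.1.symm nyx hy'
    have hxx' : r x ≤ r x' := hxmax x (.base ..)
    have hy'y : l y' ≤ l y := hymin y (.base ..)
    have g1 := hR.adj_le hux
    have g2 := hR.adj_le huy
    have hux' : G.Adj u x' := by
      rcases hR.adj_or_eq (v := u) (w := x') (by linarith) (by linarith [hR.le x']) with rfl | h
      · linarith
      · exact h
    have huy' : G.Adj u y' := by
      rcases hR.adj_or_eq (v := u) (w := y') (by linarith [hR.le y']) (by linarith) with rfl | h
      · linarith
      · exact h
    have hmem : ∀ {a b c : V}, a ∈ M → b ∈ M → a ≠ b → ¬ G.Adj a b → Reach G l r 0 a b c →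
        c ∈ M := by
      intro a b c ha hb hab nab h
      obtain ⟨p, hp⟩ := h.exists_walk_zero hab nab
      exact hM.walk_subset p ha hb (fun v hv => Or.inr (hp v hv).2.2) c p.start_mem_support
    exact ⟨2, 2, x', y', S, S', Or.inr ⟨rfl, rfl⟩, hS, hS',
      hS.subset_module hM (hmem hyM hxM dxy.1.symm nyx hy') hzM,
      hS'.subset_module hM (hmem hxM hyM dxy.1 dxy.2 hx') hzM,
      (hR.not_adj_of_lt hx'z).2, hux', huy'⟩
  rcases hF l r hR with ⟨h1, h2⟩ | ⟨h1, h2⟩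
  · exact key hR h1 h2
  · exact key hR.reflect (neg_lt_neg h2) (neg_lt_neg h1)

/-! ### Leaf orders of PQ-trees -/

namespace PQTree

variable {α : Type u}

/-- The set of labels of the leaves. -/
def leafSet (T : PQTree α) : Set α := {a | a ∈ T.frontier}

theorem mem_frontierList {a : α} {cs : List (PQTree α)} :
    a ∈ frontierList cs ↔ ∃ c ∈ cs, a ∈ c.frontier := by
  induction cs with
  | nil => simp [frontierList]
  | cons c cs ih => simp [frontierList, ih]

theorem frontierList_append (cs ds : List (PQTree α)) :
    frontierList (cs ++ ds) = frontierList cs ++ frontierList ds := by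
  induction cs with
  | nil => simp [frontierList]
  | cons c cs ih => simp [frontierList, ih]

theorem Equivalent.leafSet_eq {S T : PQTree α} (h : S.Equivalent T) : S.leafSet = T.leafSet := by
  induction h with
  | refl => rfl
  | trans _ _ ih₁ ih₂ => exact ih₁.trans ih₂
  | permute h =>
    ext a
    simp only [leafSet, frontier, Set.mem_ofPred_eq, mem_frontierList, h.mem_iff]
  | reverse cs =>
    ext a
    simp only [leafSet, frontier, Set.mem_ofPred_eq, mem_frontierList, List.mem_reverse]
  | pchild l r _ ih | qchild l r _ ih =>
    ext a
    have := Set.ext_iff.1 ih a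
    simp only [leafSet, Set.mem_ofPred_eq] at this
    simp only [leafSet, frontier, Set.mem_ofPred_eq, frontierList_append, frontierList,
      List.mem_append, this]

theorem sublist_frontierList {cs : List (PQTree α)} {as : List α} {L : List (Set α)}
    (hL : L.Sublist (cs.map leafSet)) (h : List.Forall₂ (· ∈ ·) as L) :
    as.Sublist (frontierList cs) := by
  induction cs generalizing as L with
  | nil =>
    obtain rfl : L = [] := by simpa using hL
    cases h
    exact List.nil_sublist _
  | cons c cs ih =>
    rw [List.map_cons, List.sublist_cons_iff] at hL
    rcases hL with hL | ⟨L', rfl, hL⟩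
    · exact (ih hL h).trans (List.sublist_append_right _ _)
    · cases h with
      | cons h1 h2 => exact (List.singleton_sublist.2 h1).append (ih hL h2)

/-- Three leaves lie, in this order, below three distinct children of a Q-node. -/
def Ordered (T : PQTree α) (a b c : α) : Prop :=
  ∃ cs, (qnode cs).IsSubtree T ∧ ∃ A B C : Set α, [A, B, C].Sublist (cs.map leafSet) ∧
    a ∈ A ∧ b ∈ B ∧ c ∈ C

theorem Ordered.of_equivalent {S T : PQTree α} (h : S.Equivalent T) {a b c : α}
    (ho : S.Ordered a b c) : T.Ordered a b c ∨ T.Ordered c b a := by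
  induction h generalizing a b c with
  | refl => exact Or.inl ho
  | trans _ _ ih₁ ih₂ =>
    rcases ih₁ ho with h | h
    · exact ih₂ h
    · exact (ih₂ h).symm
  | permute h =>
    obtain ⟨cs, hs, hABC⟩ := ho
    cases hs with
    | pnode _ e he hs => exact Or.inl ⟨cs, .pnode _ e (h.mem_iff.1 he) hs, hABC⟩
  | reverse ds =>
    obtain ⟨cs, hs, A, B, C, h, ha, hb, hc⟩ := ho
    cases hs with
    | refl =>
      refine Or.inr ⟨_, .refl, C, B, A, ?_, hc, hb, ha⟩
      rw [List.map_reverse]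
      exact h.reverse
    | qnode _ e he hs =>
      exact Or.inl ⟨cs, .qnode _ e (List.mem_reverse.2 he) hs, A, B, C, h, ha, hb, hc⟩
  | @pchild l r e d h ih =>
    obtain ⟨cs, hs, hABC⟩ := ho
    cases hs with
    | pnode _ e' he hs =>
      by_cases hee : e' = e
      · subst hee
        have hd : d ∈ l ++ d :: r := by simp
        exact (ih ⟨cs, hs, hABC⟩).imp (fun ⟨cs, hs, h⟩ => ⟨cs, .pnode _ d hd hs, h⟩)
          (fun ⟨cs, hs, h⟩ => ⟨cs, .pnode _ d hd hs, h⟩)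
      · have : e' ∈ l ++ d :: r := by
          simp only [List.mem_append, List.mem_cons, hee, false_or] at he ⊢
          tauto
        exact Or.inl ⟨cs, .pnode _ e' this hs, hABC⟩
  | @qchild l r e d h ih =>
    obtain ⟨cs, hs, hABC⟩ := ho
    cases hs with
    | refl =>
      refine Or.inl ⟨_, .refl, ?_⟩
      rw [List.map_append, List.map_cons, h.leafSet_eq] at hABC
      rwa [List.map_append, List.map_cons]
    | qnode _ e' he hs =>
      by_cases hee : e' = e
      · subst hee
        have hd : d ∈ l ++ d :: r := by simp
        exact (ih ⟨cs, hs, hABC⟩).imp (fun ⟨cs, hs, h⟩ => ⟨cs, .qnode _ d hd hs, h⟩)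
          (fun ⟨cs, hs, h⟩ => ⟨cs, .qnode _ d hd hs, h⟩)
      · have : e' ∈ l ++ d :: r := by
          simp only [List.mem_append, List.mem_cons, hee, false_or] at he ⊢
          tauto
        exact Or.inl ⟨cs, .qnode _ e' this hs, hABC⟩

/-- A subtree occupies a block of the leaf order and can be replaced by any equivalent one. -/
theorem IsSubtree.exists_context {S T : PQTree α} (h : S.IsSubtree T) :
    ∃ l₁ l₂, ∀ S', S.Equivalent S' → ∃ T', T.Equivalent T' ∧
      T'.frontier = l₁ ++ S'.frontier ++ l₂ := by
  induction h with
  | refl => exact ⟨[], [], fun S' h => ⟨S', h, by simp⟩⟩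
  | pnode cs c hc _ ih =>
    obtain ⟨l₁, l₂, ih⟩ := ih
    obtain ⟨l, r, rfl⟩ := List.append_of_mem hc
    refine ⟨frontierList l ++ l₁, l₂ ++ frontierList r, fun S' h => ?_⟩
    obtain ⟨T', h1, h2⟩ := ih S' h
    exact ⟨_, .pchild l r h1, by simp [frontier, frontierList_append, frontierList, h2]⟩
  | qnode cs c hc _ ih =>
    obtain ⟨l₁, l₂, ih⟩ := ih
    obtain ⟨l, r, rfl⟩ := List.append_of_mem hc
    refine ⟨frontierList l ++ l₁, l₂ ++ frontierList r, fun S' h => ?_⟩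
    obtain ⟨T', h1, h2⟩ := ih S' h
    exact ⟨_, .qchild l r h1, by simp [frontier, frontierList_append, frontierList, h2]⟩

theorem Ordered.sublist_frontier {T : PQTree α} {a b c : α} (h : T.Ordered a b c) :
    [a, b, c].Sublist T.frontier := by
  obtain ⟨cs, hs, A, B, C, h, ha, hb, hc⟩ := h
  have h1 : [a, b, c].Sublist (qnode cs).frontier :=
    sublist_frontierList h (.cons ha (.cons hb (.cons hc .nil)))
  generalize qnode cs = S at hs h1
  induction hs with
  | refl => exact h1
  | pnode cs c hc _ ih | qnode cs c hc _ ih =>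
    obtain ⟨l, r, rfl⟩ := List.append_of_mem hc
    refine ih.trans ?_
    simp only [frontier, frontierList_append, frontierList]
    exact (List.sublist_append_left _ _).trans (List.sublist_append_right _ _)

theorem Proper.of_isSubtree {S T : PQTree α} (hT : T.Proper) (h : S.IsSubtree T) : S.Proper := by
  induction h with
  | refl => exact hT
  | pnode cs c hc _ ih => cases hT with | pnode _ _ h => exact ih (h c hc)
  | qnode cs c hc _ ih => cases hT with | qnode _ _ h => exact ih (h c hc)

theorem Proper.exists_mem_frontier {T : PQTree α} (hT : T.Proper) : ∃ a, a ∈ T.frontier := by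
  induction hT with
  | leaf a => exact ⟨a, by simp [frontier]⟩
  | pnode cs h _ ih | qnode cs h _ ih =>
    have hc : cs[0]'(by omega) ∈ cs := List.getElem_mem _
    obtain ⟨a, ha⟩ := ih _ hc
    exact ⟨a, mem_frontierList.2 ⟨_, hc, ha⟩⟩

end PQTree

/-- The points of a representation at which the maximal cliques are found order them
consecutively. -/
theorem IsRep.exists_consecutiveOrdering [Finite V] (hR : IsRep G l r) :
    ∃ (p : Set V → ℝ) (L : List (Set V)), (∀ s, G.IsClique s → ∀ v ∈ s, l v ≤ p s ∧ p s ≤ r v) ∧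
      IsConsecutiveOrdering G L ∧ L.Pairwise fun s t => p s ≤ p t := by
  classical
  have hp : ∀ s : Set V, ∃ q : ℝ, G.IsClique s → ∀ v ∈ s, l v ≤ q ∧ q ≤ r v := by
    intro s
    by_cases hs : s.Nonempty
    · obtain ⟨m, hm, hmax⟩ := Set.exists_max_image s l (Set.toFinite _) hs
      refine ⟨l m, fun hc v hv => ⟨hmax v hv, ?_⟩⟩
      by_cases hvm : v = m
      · rw [hvm]; exact hR.le m
      · exact (hR.adj_le (hc hv hm hvm)).2
    · exact ⟨0, fun _ v hv => absurd ⟨v, hv⟩ hs⟩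
  choose p hp using hp
  have hfin : {s : Set V | Maximal G.IsClique s}.Finite := Set.toFinite _
  let L : List (Set V) := hfin.toFinset.toList.mergeSort (fun s t => decide (p s ≤ p t))
  have hperm : L.Perm hfin.toFinset.toList := List.mergeSort_perm _ _
  have hpair : L.Pairwise fun s t => p s ≤ p t := by
    have := List.pairwise_mergeSort (le := fun s t : Set V => decide (p s ≤ p t))
      (fun a b c h1 h2 => by simp only [decide_eq_true_eq] at *; linarith)
      (fun a b => by simpa using le_total (p a) (p b)) hfin.toFinset.toList
    simpa using this
  have hmem : ∀ s, s ∈ L ↔ Maximal G.IsClique s := fun s => by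
    rw [hperm.mem_iff]
    simp
  refine ⟨p, L, hp, ⟨hperm.nodup_iff.2 (Finset.nodup_toList _), hmem, ?_⟩, hpair⟩
  rintro a b c hs v ⟨hva, hvc⟩
  have h1 := hpair.sublist hs
  have ha := (hmem a).1 (hs.subset (by simp))
  have hb := (hmem b).1 (hs.subset (by simp))
  have hc := (hmem c).1 (hs.subset (by simp))
  simp only [List.pairwise_cons, List.mem_cons, List.not_mem_nil, or_false] at h1
  have h2 : p a ≤ p b := h1.1 b (Or.inl rfl)
  have h3 : p b ≤ p c := h1.2.1 c rfl
  have h4 := hp a ha.prop v hva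
  have h5 := hp c hc.prop v hvc
  refine hb.le_of_ge (y := insert v b) ?_ (Set.subset_insert v b) (Set.mem_insert v b)
  refine SimpleGraph.IsClique.insert hb.prop fun w hw hvw => ?_
  have h6 := hp b hb.prop w hw
  exact (hR.adj_iff v w hvw).2 ⟨by linarith, by linarith⟩

/-- Vertices that are not adjacent and belong to maximal cliques below three different children
of a Q-node are drawn in the order of these children or in the reverse order. -/
theorem PQTree.Represents.forced [Finite V] {T : PQTree (Set V)} (hT : T.Represents G)
    {a b c : Set V} (ho : T.Ordered a b c) {x y z : V} (hx : x ∈ a) (hy : y ∈ c) (hz : z ∈ b)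
    (hxz : x ≠ z) (hyz : y ≠ z) (nxz : ¬ G.Adj x z) (nyz : ¬ G.Adj y z) : Forced G x z y := by
  intro l r hR
  obtain ⟨p, L, hp, hL, hpair⟩ := hR.exists_consecutiveOrdering
  obtain ⟨T', hTT', rfl⟩ := (hT.2 L).2 hL
  have hcl : ∀ s ∈ T'.frontier, ∀ v ∈ s, l v ≤ p s ∧ p s ≤ r v := fun s hs =>
    hp s ((hL.2.1 s).1 hs).prop
  rcases ho.of_equivalent hTT' with h | h
  all_goals
    have hs := h.sublist_frontier
    have h1 := hpair.sublist hs
    simp only [List.pairwise_cons, List.mem_cons, List.not_mem_nil, or_false] at h1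
    have ha := hcl a (hs.subset (by simp)) x hx
    have hb := hcl b (hs.subset (by simp)) z hz
    have hc := hcl c (hs.subset (by simp)) y hy
  · have h2 : p a ≤ p b := h1.1 b (Or.inl rfl)
    have h3 : p b ≤ p c := h1.2.1 c rfl
    exact Or.inl ⟨(hR.lt_or_lt hxz nxz).resolve_right (by linarith),
      (hR.lt_or_lt hyz nyz).resolve_left (by linarith)⟩
  · have h2 : p c ≤ p b := h1.1 b (Or.inl rfl)
    have h3 : p b ≤ p a := h1.2.1 a rfl
    exact Or.inr ⟨(hR.lt_or_lt hyz nyz).resolve_right (by linarith),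
      (hR.lt_or_lt hxz nxz).resolve_left (by linarith)⟩

/-! ### The vertices below a Q-node -/

/-- A vertex that belongs to a maximal clique below a Q-node and to another one that is not below
it belongs to all maximal cliques below the Q-node. -/
theorem PQTree.Represents.mem_of_notMem_subtreeVertices {T : PQTree (Set V)}
    (hT : T.Represents G) {cs : List (PQTree (Set V))} (hQ : (qnode cs).IsSubtree T) {v : V}
    (hv : v ∉ subtreeVertices G (qnode cs)) {d e : Set V} (hd : d ∈ (qnode cs).frontier)
    (hvd : v ∈ d) (he : e ∈ (qnode cs).frontier) : v ∈ e := by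
  obtain ⟨l₁, l₂, hctx⟩ := hQ.exists_context
  have hcons : ∀ ds, (qnode cs).Equivalent (qnode ds) →
      IsConsecutiveOrdering G (l₁ ++ frontierList ds ++ l₂) := by
    intro ds h
    obtain ⟨T', h1, h2⟩ := hctx _ h
    exact (hT.2 _).1 ⟨T', h1, h2⟩
  have hcs := hcons cs (.refl _)
  have hrev := hcons cs.reverse (.reverse cs)
  simp only [subtreeVertices, Set.mem_ofPred_eq, not_forall] at hv
  obtain ⟨s, hs, hvs, hsF⟩ := hv
  have hsl : s ∈ l₁ ∨ s ∈ l₂ := by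
    have := (hcs.2.1 s).2 hs
    simp only [List.mem_append] at this
    rcases this with (h | h) | h
    · exact Or.inl h
    · exact absurd h hsF
    · exact Or.inr h
  -- Reversing the Q-node if need be, any leaf below another child gets between `d` and `s`.
  have hpull : ∀ ds, IsConsecutiveOrdering G (l₁ ++ frontierList ds ++ l₂) → ∀ f g : Set V, v ∈ f →
      (s ∈ l₁ ∧ [g, f].Sublist (frontierList ds) ∨ s ∈ l₂ ∧ [f, g].Sublist (frontierList ds)) →
      v ∈ g := by
    rintro ds hds f g hvf (⟨h1, h2⟩ | ⟨h1, h2⟩)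
    · refine hds.2.2 s g f ?_ ⟨hvs, hvf⟩
      exact ((List.singleton_sublist.2 h1).append h2).trans (List.sublist_append_left _ _)
    · refine hds.2.2 f g s ?_ ⟨hvf, hvs⟩
      rw [List.append_assoc]
      exact (h2.append (List.singleton_sublist.2 h1)).trans (List.sublist_append_right _ _)
  have hpair : ∀ i j (hi : i < cs.length) (hj : j < cs.length), i < j → ∀ f ∈ cs[i].frontier,
      ∀ g ∈ cs[j].frontier, [f, g].Sublist (frontierList cs) ∧
        [g, f].Sublist (frontierList cs.reverse) := by
    intro i j hi hj hij f hf g hg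
    have h : [cs[i], cs[j]].Sublist cs := by
      simpa using List.map_getElem_sublist (l := cs) (is := [⟨i, hi⟩, ⟨j, hj⟩]) (by simpa using hij)
    exact ⟨sublist_frontierList (h.map leafSet) (.cons hf (.cons hg .nil)),
      sublist_frontierList (h.reverse.map leafSet) (.cons hg (.cons hf .nil))⟩
  have hother : ∀ i j (hi : i < cs.length) (hj : j < cs.length), i ≠ j → ∀ f ∈ cs[i].frontier,
      ∀ g ∈ cs[j].frontier, v ∈ f → v ∈ g := by
    intro i j hi hj hij f hf g hg hvf
    rcases lt_or_gt_of_ne hij with h | h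
    · have h1 := hpair i j hi hj h f hf g hg
      rcases hsl with h2 | h2
      · exact hpull _ hrev f g hvf (Or.inl ⟨h2, h1.2⟩)
      · exact hpull _ hcs f g hvf (Or.inr ⟨h2, h1.1⟩)
    · have h1 := hpair j i hj hi h g hg f hf
      rcases hsl with h2 | h2
      · exact hpull _ hcs f g hvf (Or.inl ⟨h2, h1.1⟩)
      · exact hpull _ hrev f g hvf (Or.inr ⟨h2, h1.2⟩)
  have hidx : ∀ f ∈ (qnode cs).frontier, ∃ i, ∃ hi : i < cs.length, f ∈ cs[i].frontier := by
    intro f hf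
    obtain ⟨c, hc, hfc⟩ := mem_frontierList.1 hf
    obtain ⟨i, hi, rfl⟩ := List.getElem_of_mem hc
    exact ⟨i, hi, hfc⟩
  obtain ⟨i, hi, hd⟩ := hidx d hd
  obtain ⟨k, hk, he⟩ := hidx e he
  cases hT.1.of_isSubtree hQ with
  | qnode _ hlen hproper =>
    have hj : ∃ j, j < cs.length ∧ i ≠ j ∧ j ≠ k := by
      by_cases h0 : i ≠ 0 ∧ k ≠ 0
      · exact ⟨0, by omega, by omega, by omega⟩
      · by_cases h1 : i ≠ 1 ∧ k ≠ 1
        · exact ⟨1, by omega, by omega, by omega⟩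
        · exact ⟨2, by omega, by omega, by omega⟩
    obtain ⟨j, hj, hij, hjk⟩ := hj
    obtain ⟨f, hf⟩ := (hproper cs[j] (List.getElem_mem _)).exists_mem_frontier
    exact hother j k hj hk hjk f hf e he (hother i j hi hj hij d hd f hf hvd)

theorem exists_maximal_clique [Finite V] {s : Set V} (hs : G.IsClique s) :
    ∃ t, Maximal G.IsClique t ∧ s ⊆ t := by
  obtain ⟨t, h1, h2⟩ := (Set.toFinite {t : Set V | G.IsClique t}).exists_le_maximal hs
  exact ⟨t, h2, h1⟩

theorem PQTree.Represents.isModule_subtreeVertices [Finite V] {T : PQTree (Set V)}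
    (hT : T.Represents G) {cs : List (PQTree (Set V))} (hQ : (qnode cs).IsSubtree T) :
    IsModule G (subtreeVertices G (qnode cs)) := by
  intro v hv m hm hvm m' hm'
  obtain ⟨d, hd, hvd⟩ := exists_maximal_clique (s := {v, m})
    (by rw [SimpleGraph.isClique_pair]; exact fun _ => hvm)
  obtain ⟨e, he, hme⟩ := exists_maximal_clique (G := G) (s := {m'}) (by simp)
  have hve := hT.mem_of_notMem_subtreeVertices hQ hv (hm d hd (hvd (by simp))) (hvd (by simp))
    (hm' e he (hme rfl))
  refine he.prop hve (hme rfl) ?_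
  rintro rfl
  exact hv hm'

/-! ### Obstructions in induced subgraphs -/

theorem FATGraph.induce {k : ℕ} {S : Set V} {x y z : V} (h : FATGraph G k S x y z) {B : Set V}
    (hB : S ⊆ B) (hx : x ∈ B) (hy : y ∈ B) (hz : z ∈ B) :
    FATGraph (G.induce B) k (Subtype.val ⁻¹' S) ⟨x, hx⟩ ⟨y, hy⟩ ⟨z, hz⟩ := by
  have hsupp : ∀ {a b : V} (p : G.Walk a b) (hp : ∀ v ∈ p.support, v ∈ B) (v : B),
      v ∈ (p.induce B hp).support ↔ (v : V) ∈ p.support := by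
    intro a b p hp v
    rw [SimpleGraph.Walk.support_induce, List.mem_attachWith]
  have hedges : ∀ {a b : V} (p : G.Walk a b) (hp : ∀ v ∈ p.support, v ∈ B),
      (p.induce B hp).edges.map (Sym2.map Subtype.val) = p.edges := by
    intro a b p
    induction p with
    | nil => simp
    | cons h p ih => intro hp; simp [ih]
  have hpath : ∀ {a b : V} (p : G.Walk a b) (hp : ∀ v ∈ p.support, v ∈ B), p.IsPath →
      p.IsChordless → (p.induce B hp).IsPath ∧ (p.induce B hp).IsChordless := by
    intro a b p hp h1 h2
    constructor
    · rw [SimpleGraph.Walk.isPath_def] at h1 ⊢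
      refine List.Nodup.of_map Subtype.val ?_
      rwa [SimpleGraph.Walk.support_induce, List.attachWith_map_subtype_val]
    · rw [SimpleGraph.Walk.isChordless_iff_forall_mem_edges] at h2 ⊢
      intro v w hv hw hvw
      have := h2 ((hsupp p hp v).1 hv) ((hsupp p hp w).1 hw) hvw
      rw [← hedges p hp, List.mem_map] at this
      obtain ⟨e, he, hev⟩ := this
      have : e = s(v, w) := Sym2.map.injective Subtype.val_injective hev
      rwa [← this]
  induction h with
  | one x y z p hxz h1 h2 hp =>
    have hpB : ∀ v ∈ p.support, v ∈ B := fun v hv => hB (Or.inr hv)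
    obtain ⟨h3, h4⟩ := hpath p hpB h1 h2
    convert FATGraph.one (G := G.induce B) ⟨x, hx⟩ ⟨y, hy⟩ ⟨z, hz⟩ (p.induce B hpB)
      (fun h => hxz (congrArg Subtype.val h)) h3 h4 ?_ using 1
    · ext v
      simp only [Set.mem_preimage, Set.mem_insert_iff, Set.mem_ofPred_eq, hsupp, Subtype.ext_iff]
    · intro v hv
      have := hp v ((hsupp p hpB v).1 hv)
      exact ⟨fun h => this.1 (congrArg Subtype.val h), this.2⟩
  | succ k S x y z h x' t p hxt h1 h2 hdisj hxt' ht hnadj ih =>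
    have hpB : ∀ v ∈ p.support, v ∈ B := fun v hv => hB (Or.inr hv)
    have hSB : S ⊆ B := fun v hv => hB (Or.inl hv)
    have hxB := hSB h.mem.1
    obtain ⟨h3, h4⟩ := hpath p hpB h1 h2
    convert FATGraph.succ (G := G.induce B) k _ ⟨x, hxB⟩ ⟨y, hz⟩ ⟨z, hy⟩
      (ih hSB hxB hz hy) ⟨x', hx⟩ ⟨t, hpB t p.end_mem_support⟩ (p.induce B hpB)
      (fun h => hxt (congrArg Subtype.val h)) h3 h4 ?_ hxt' ?_ ?_ using 1
    · ext v
      simp only [Set.mem_preimage, Set.mem_union, Set.mem_ofPred_eq, hsupp]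
    · intro v hv hvS
      exact hdisj v ((hsupp p hpB v).1 hv) hvS
    · intro s hs hsx
      exact ht s hs fun h => hsx (Subtype.ext h)
    · intro v hv hvt s hs
      exact hnadj v ((hsupp p hpB v).1 hv) (fun h => hvt (Subtype.ext h)) s hs

/-- A complete partial representation is a representation. -/
theorem PartialRep.isRep (R : PartialRep G) (h : R.pre = Set.univ) : IsRep G R.left R.right := by
  refine ⟨fun v => R.left_le_right v (by simp [h]), fun v w hvw => ?_⟩
  have hv := R.left_le_right v (by simp [h])
  have hw := R.left_le_right w (by simp [h])
  rw [R.adj_iff v (by simp [h]) w (by simp [h]) hvw, Set.Icc_inter_Icc, Set.nonempty_Icc,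
    sup_le_iff, le_inf_iff, le_inf_iff]
  tauto

/-- Two graphs `H_k` and `H'_ℓ` with `x` and `y` interchanged force `z` between `x` and `y`. A
common neighbour `u` of `x` and `y` then covers `z`, which single overlapping intervals of `u` and
`z` exclude. -/
theorem not_extendible_of_fatGraph {R : PartialRep G} {k m : ℕ} {S S' : Set V} {x y z u : V}
    (hS : FATGraph G k S x y z) (hS' : FATGraph G m S' y x z) (nxz : ¬ G.Adj x z)
    (hux : G.Adj u x) (huy : G.Adj u y) (hzpre : z ∈ R.pre) (hupre : u ∈ R.pre)
    (hov : SingleOverlap (R.interval u) (R.interval z)) : ¬ R.Extendible := by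
  rintro ⟨E, hE, hext⟩
  have hR := E.isRep hE
  obtain ⟨⟨hxy, hxz, hyz⟩, nxy, nyz⟩ := hS.ne_and_not_adj
  have g1 := hR.adj_le hux
  have g2 := hR.adj_le huy
  have h1 := hS.not_btw hR
  have h2 := hS'.not_btw hR
  have lx := hR.le x
  have ly := hR.le y
  have lz := hR.le z
  refine hov.2.2 ?_
  unfold PartialRep.interval
  rw [← (hext z hzpre).1, ← (hext z hzpre).2, ← (hext u hupre).1, ← (hext u hupre).2]
  refine Set.Icc_subset_Icc ?_ ?_ <;>
  rcases hR.lt_or_lt hxz nxz with h3 | h3 <;> rcases hR.lt_or_lt hyz nyz with h4 | h4 <;>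
  rcases hR.lt_or_lt hxy nxy with h5 | h5 <;>
  first
    | linarith
    | exact (h1 (Or.inl ⟨h5, h4⟩)).elim
    | exact (h1 (Or.inr ⟨h4, h5⟩)).elim
    | exact (h2 (Or.inl ⟨h5, h3⟩)).elim
    | exact (h2 (Or.inr ⟨h3, h5⟩)).elim

/-- Two graphs `H_k` and `H'_ℓ` within a set `A` of vertices make a `(k, ℓ)`-CE obstruction. -/
theorem containsCE_of_fatGraph {R : PartialRep G} {A : Set V} {k m : ℕ} {S S' : Set V}
    {x y z u : V} (hS : FATGraph G k S x y z) (hS' : FATGraph G m S' y x z)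
    (hA : S ⊆ A) (hA' : S' ⊆ A) (huA : u ∈ A) (nxz : ¬ G.Adj x z) (hux : G.Adj u x)
    (huy : G.Adj u y) (huz : G.Adj u z) (hzpre : z ∈ R.pre) (hupre : u ∈ R.pre)
    (hov : SingleOverlap (R.interval u) (R.interval z)) :
    ContainsCE k m ((R.restrict {z, u}).induce A) := by
  have hB : S ∪ S' ∪ {u} ⊆ A := Set.union_subset (Set.union_subset hA hA') (by simpa using huA)
  obtain ⟨hxS, hyS, hzS⟩ := hS.mem
  obtain ⟨⟨hxy, hxz, hyz⟩, nxy, nyz⟩ := hS.ne_and_not_adj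
  let B : Set V := S ∪ S' ∪ {u}
  have hxB : x ∈ B := Or.inl (Or.inl hxS)
  have hyB : y ∈ B := Or.inl (Or.inl hyS)
  have hzB : z ∈ B := Or.inl (Or.inl hzS)
  have huB : u ∈ B := Or.inr rfl
  have hSB := hS.induce (B := B) (fun v hv => Or.inl (Or.inl hv)) hxB hyB hzB
  have hSB' := hS'.induce (B := B) (fun v hv => Or.inl (Or.inr hv)) hyB hxB hzB
  let RB := (R.restrict {z, u}).induce B
  refine ⟨B, G.induce B, RB, ?_, SimpleGraph.induceHomOfLE G hB, fun w hw => hw,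
    fun v _ w _ => ⟨Iff.rfl, Iff.rfl, Iff.rfl, Iff.rfl⟩⟩
  have hne : ∀ {a b : V} (ha : a ∈ B) (hb : b ∈ B), a ≠ b → (⟨a, ha⟩ : B) ≠ ⟨b, hb⟩ :=
    fun _ _ h h' => h (congrArg Subtype.val h')
  refine ⟨⟨x, hxB⟩, ⟨y, hyB⟩, ⟨z, hzB⟩, ⟨u, huB⟩, _, _, hSB, hSB', ?_, hne _ _ hxy, hne _ _ hxz,
    hne _ _ hyz, nxy, nxz, nyz, hux, huy, huz, ?_, hov, ?_⟩
  · ext ⟨v, hv⟩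
    simp only [Set.mem_union, Set.mem_preimage, Set.mem_singleton_iff, Subtype.mk.injEq,
      Set.mem_univ, iff_true]
    exact hv
  · ext ⟨v, hv⟩
    simp only [RB, PartialRep.induce, PartialRep.restrict, Set.mem_ofPred_eq, Set.mem_inter_iff,
      Set.mem_insert_iff, Set.mem_singleton_iff, Subtype.mk.injEq]
    constructor
    · exact fun h => h.2
    · rintro (rfl | rfl)
      · exact ⟨hzpre, Or.inl rfl⟩
      · exact ⟨hupre, Or.inr rfl⟩
  · exact not_extendible_of_fatGraph (R := RB) (u := ⟨u, huB⟩) hSB hSB' nxz hux huy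
      ⟨hzpre, Or.inl rfl⟩ ⟨hupre, Or.inr rfl⟩ hov

end IntervalExt

theorem mainTheorem3 {V : Type u} [Finite V] (G : SimpleGraph V)
    (hG : IntervalExt.IsIntervalGraph G) (R : IntervalExt.PartialRep G)
    (T : IntervalExt.PQTree (Set V)) (hT : T.Represents G)
    (cs : List (IntervalExt.PQTree (Set V)))
    (hQ : (IntervalExt.PQTree.qnode cs).IsSubtree T)
    (α β γ : Fin cs.length) (hαβ : α < β) (hβγ : β < γ)
    (a b c : Set V) (ha : a ∈ (cs.get α).frontier) (hb : b ∈ (cs.get β).frontier)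
    (hc : c ∈ (cs.get γ).frontier)
    (x y z u : V) (hx : x ∈ a) (hy : y ∈ c) (hz : z ∈ b) (hzpre : z ∈ R.pre)
    (hxy : x ≠ y) (hxz : x ≠ z) (hyz : y ≠ z)
    (nxy : ¬ G.Adj x y) (nxz : ¬ G.Adj x z) (nyz : ¬ G.Adj y z)
    (hupre : u ∈ R.pre) (hux : G.Adj u x) (huy : G.Adj u y) (huz : G.Adj u z)
    (hov : IntervalExt.SingleOverlap (R.interval u) (R.interval z)) :
    ∃ k l : ℕ, ((1 ≤ k ∧ l = 1) ∨ (k = 2 ∧ l = 2)) ∧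
      IntervalExt.ContainsCE k l
        ((R.restrict {z, u}).induce
          (IntervalExt.subtreeVertices G (IntervalExt.PQTree.qnode cs) ∪ {u})) := by
  obtain ⟨E, hE⟩ := hG
  have hR := E.isRep hE
  have hsub : [cs.get α, cs.get β, cs.get γ].Sublist cs := by
    simpa using List.map_getElem_sublist (l := cs) (is := [α, β, γ])
      (by simp [hαβ, hβγ, hαβ.trans hβγ])
  have ho : T.Ordered a b c :=
    ⟨cs, hQ, _, _, _, hsub.map IntervalExt.PQTree.leafSet, ha, hb, hc⟩
  have hF := hT.forced ho hx hy hz hxz hyz nxz nyz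
  have hleaf : ∀ i : Fin cs.length, ∀ d ∈ (cs.get i).frontier,
      d ∈ (IntervalExt.PQTree.qnode cs).frontier := fun i d hd =>
    IntervalExt.PQTree.mem_frontierList.2 ⟨_, List.get_mem _ _, hd⟩
  have hclique : ∀ d ∈ T.frontier, G.IsClique d := fun d hd =>
    ((((hT.2 _).1 ⟨T, .refl T, rfl⟩).2.1 d).1 hd).prop
  have hs := ho.sublist_frontier
  have hac := hclique a (hs.subset (by simp))
  have hcc := hclique c (hs.subset (by simp))
  -- A vertex above the Q-node would be adjacent to all vertices below it.
  have hxM : x ∈ IntervalExt.subtreeVertices G (.qnode cs) := by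
    by_contra h
    exact nxy (hcc (hT.mem_of_notMem_subtreeVertices hQ h (hleaf α a ha) hx (hleaf γ c hc))
      hy hxy)
  have hyM : y ∈ IntervalExt.subtreeVertices G (.qnode cs) := by
    by_contra h
    exact nxy (hac hx (hT.mem_of_notMem_subtreeVertices hQ h (hleaf γ c hc) hy (hleaf α a ha))
      hxy)
  have hzM : z ∈ IntervalExt.subtreeVertices G (.qnode cs) := by
    by_contra h
    exact nxz (hac hx (hT.mem_of_notMem_subtreeVertices hQ h (hleaf β b hb) hz (hleaf α a ha))
      hxz)
  obtain ⟨k, m, x', y', S, S', hkm, hS, hS', hSM, hSM', nxz', hux', huy'⟩ :=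
    hF.exists_fatGraphs hR hux huy (hT.isModule_subtreeVertices hQ) hxM hyM hzM
  exact ⟨k, m, hkm, IntervalExt.containsCE_of_fatGraph hS hS'
    (hSM.trans Set.subset_union_left) (hSM'.trans Set.subset_union_left) (Or.inr rfl) nxz' hux'
    huy' huz hzpre hupre hov⟩
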